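/- **Completeness of Reset Arithmetic.** For all finite sets $\Gamma,\Delta$ of formulas: if $\mathit{PA}\vdash\Gamma\Rightarrow\Delta$, then $\mathit{RA}\vdash\Gamma\Rightarrow\Delta$. Here the notions are as follows. *Syntax.* Terms are built from variables, $0$, $S$, $+$, $\cdot$; formulas from $s=t$, $s<t$, $\bot$, $\wedge,\vee,\to,\forall x,\exists x$ (not identified up to renaming of bound variables). $\varphi[t/x]$ replaces the free occurrences of $x$; it is defined only if no free variable of $t$ is bound in $\varphi$, and writing it asserts that it is defined (likewise for sets of formulas and for the simultaneous substitution $[s/x,t/y]$, $x\neq y$). A sequent $\Gamma\Rightarrow\Delta$ consists of two finite sets of formulas. $\mathrm{Term}(\Gamma\Rightarrow\Delta)$ is the set of terms that have a free occurrence, possibly as a subterm, in a formula of $\Gamma$ or $\Delta$ (no variable of that occurrence is bound there). *Preproofs.* A preproof is a finite tree, labelled by sequents and rule instances, in which some leaves (buds) are linked to a proper ancestor (their companion) with the same label, and every other node is either the conclusion of a rule instance whose premises label its children, or a leaf. It has no assumptions if every leaf that is not a bud carries a rule instance without premises. *Rules of $\mathit{CA}$.* (Ax) $\Gamma,\varphi\Rightarrow\varphi,\Delta$;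 ($\bot$L) $\Gamma,\bot\Rightarrow\Delta$; ($=$R) $\Gamma\Rightarrow t=t,\Delta$; the rules (premises / conclusion) - $\Gamma,\psi\Rightarrow\Delta$ and $\Gamma\Rightarrow\varphi,\Delta$ / $\Gamma,\varphi\to\psi\Rightarrow\Delta$; $\ \Gamma,\varphi\Rightarrow\psi,\Delta$ / $\Gamma\Rightarrow\varphi\to\psi,\Delta$; - $\Gamma,\varphi,\psi\Rightarrow\Delta$ / $\Gamma,\varphi\wedge\psi\Rightarrow\Delta$; $\ \Gamma\Rightarrow\varphi,\Delta$ and $\Gamma\Rightarrow\psi,\Delta$ / $\Gamma\Rightarrow\varphi\wedge\psi,\Delta$; - $\Gamma,\varphi\Rightarrow\Delta$ and $\Gamma,\psi\Rightarrow\Delta$ / $\Gamma,\varphi\vee\psi\Rightarrow\Delta$; $\ \Gamma\Rightarrow\varphi,\psi,\Delta$ / $\Gamma\Rightarrow\varphi\vee\psi,\Delta$; - $\Gamma,\varphi[t/x]\Rightarrow\Delta$ / $\Gamma,\forall x.\varphi\Rightarrow\Delta$; $\ \Gamma\Rightarrow\varphi,\Delta$ / $\Gamma\Rightarrow\forall x.\varphi,\Delta$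 if $x\notin\mathrm{FV}(\Gamma,\Delta)$; - $\Gamma,\varphi\Rightarrow\Delta$ / $\Gamma,\exists x.\varphi\Rightarrow\Delta$ if $x\notin\mathrm{FV}(\Gamma,\Delta)$; $\ \Gamma\Rightarrow\varphi[t/x],\Delta$ / $\Gamma\Rightarrow\exists x.\varphi,\Delta$; - ($=$L) $\Gamma[t/x,s/y]\Rightarrow\Delta[t/x,s/y]$ / $\Gamma[s/x,t/y],s=t\Rightarrow\Delta[s/x,t/y]$ for $x\ne y$, $x,y\notin\mathrm{FV}(s,t)$; - (Wk) $\Gamma\Rightarrow\Delta$ / $\Gamma,\Gamma'\Rightarrow\Delta,\Delta'$; (Cut) $\Gamma,\varphi\Rightarrow\Delta$ and $\Gamma\Rightarrow\varphi,\Delta$ / $\Gamma\Rightarrow\Delta$; (Sub) $\Gamma\Rightarrow\Delta$ / $\Gamma[s/x]\Rightarrow\Delta[s/x]$; - (S) $\Gamma,t=Sx\Rightarrow\Delta$ / $\Gamma,0<t\Rightarrow\Delta$ if $x\notin\mathrm{FV}(\Gamma,\Delta,t)$; and the arithmetical axioms $s<t,t<u\Rightarrow s<u$; $\ s<t,t<s\Rightarrow$;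 $\ s<t,t<Ss\Rightarrow$; $\ t<0\Rightarrow$; $\ s<t\Rightarrow Ss<St$; $\ \Rightarrow s<t,s=t,t<s$; $\ \Rightarrow t<St$; $\ \Rightarrow t+0=t$; $\ \Rightarrow s+St=S(s+t)$; $\ \Rightarrow t\cdot 0=0$; $\ \Rightarrow s\cdot St=(s\cdot t)+s$. *Peano arithmetic.* $\mathit{PA}\vdash\Gamma\Rightarrow\Delta$ means that $\Gamma\Rightarrow\Delta$ is the root of a preproof without buds and without assumptions that uses the rules of $\mathit{CA}$ and the induction axioms $\Rightarrow(\forall x.(\forall y.\,y<x\to\varphi[y/x])\to\varphi)\to\forall x.\varphi$, where $y\neq x$ and $y$ is not free in $\varphi$. *Reset arithmetic.* $\mathit{RA}$-sequents are expressions $\Theta;\sigma\mid\Gamma\Rightarrow\Delta$, where $\Theta$ (the control) is a finite sequence of distinct letters from a countably infinite alphabet and $\sigma$ is a finite set of assignments $t\mapsto u$ with $t\in\mathrm{Term}(\Gamma\Rightarrow\Delta)$ and $u$ a subsequence of $\Theta$. For a premise, $\Theta';\sigma'$ arises from $\Theta;\sigma$ by first removing the assignments to terms that do not occur in that premise and then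 the letters of $\Theta$ that are no longer assigned to any term. The rules of $\mathit{RA}$ are: - (Ax), ($\bot$L), ($=$R) and the arithmetical axioms, with any control and assignments; - $\to$R, $\wedge$L, $\vee$R, $\forall$L, $\forall$R, $\exists$L, (Cut), (S), with the same $\Theta;\sigma$ in the conclusion and all premises; - $\to$L, $\wedge$R, $\vee$L, $\exists$R, with $\Theta;\sigma$ in the conclusion and $\Theta';\sigma'$ in each premise; - ($=$L) with $\Theta;\sigma[t/x,s/y]$ in the premise and $\Theta;\sigma[s/x,t/y]$ in the conclusion; (Sub) with $\Theta;\sigma$ in the premise and $\Theta;\sigma[s/x]$ in the conclusion; - (Wk) $\Theta';\sigma\mid\Gamma\Rightarrow\Delta$ / $\Theta;\sigma,\sigma^*\mid\Gamma,\Gamma^*\Rightarrow\Delta,\Delta^*$; - (Focus) $\Theta;\sigma,(t\mapsto\varepsilon)\mid\Gamma\Rightarrow\Delta$ / $\Theta;\sigma\mid\Gamma\Rightarrow\Delta$ for $t\in\mathrm{Term}(\Gamma\Rightarrow\Delta)$; - ($<$L) $\Theta a;\sigma,(s\mapsto ua)\mid\Gamma\Rightarrow\Delta$ / $\Theta;\sigma,(t\mapsto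 u)\mid\Gamma,s<t\Rightarrow\Delta$ for $a\notin\Theta$; - ($\mathrm{Reset}_a$) $\Theta';\sigma,(t_1\mapsto ua),\dots,(t_n\mapsto ua)\mid\Gamma\Rightarrow\Delta$ / $\Theta;\sigma,(t_1\mapsto uau_1),\dots,(t_n\mapsto uau_n)\mid\Gamma\Rightarrow\Delta$, where $n\ge1$, all $u_i$ are non-empty and $a$ does not occur in $\sigma$. $\mathit{RA}\vdash\Gamma\Rightarrow\Delta$ means that there is an $\mathit{RA}$-preproof without assumptions whose root is labelled $\varepsilon;\emptyset\mid\Gamma\Rightarrow\Delta$ and in which every bud $t$ with companion $c$ has an invariant: a letter $a$ that occurs in all controls on the path from $c$ to $t$, with the same prefix before $a$ in all of them, such that $\mathrm{Reset}_a$ is applied on that path. -/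

import Mathlib

namespace ResetArithmetic

/-! ### Terms and formulas (variables are natural numbers) -/

inductive Term : Type
  | var (x : ℕ)
  | zero
  | succ (s : Term)
  | add (s t : Term)
  | mul (s t : Term)
  deriving DecidableEq

/-- Formulas with named variables; they are not identified up to renaming of bound variables. -/
inductive Form : Type
  | eq (s t : Term)
  | lt (s t : Term)
  | bot
  | and (φ ψ : Form)
  | or (φ ψ : Form)
  | imp (φ ψ : Form)
  | all (x : ℕ) (φ : Form)
  | ex (x : ℕ) (φ : Form)
  deriving DecidableEq

namespace Term

/-- The variables of a term. -/
def fv : Term → Finset ℕ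
  | var x => {x}
  | zero => ∅
  | succ s => s.fv
  | add s t => s.fv ∪ t.fv
  | mul s t => s.fv ∪ t.fv

/-- The subterms of a term, the term itself included. -/
def subterms : Term → Finset Term
  | var x => {var x}
  | zero => {zero}
  | succ s => insert (succ s) s.subterms
  | add s t => insert (add s t) (s.subterms ∪ t.subterms)
  | mul s t => insert (mul s t) (s.subterms ∪ t.subterms)

/-- Simultaneous substitution. -/
def subst (f : ℕ → Term) : Term → Term
  | var x => f x
  | zero => zero
  | succ s => succ (s.subst f)
  | add s t => add (s.subst f) (t.subst f)
  | mul s t => mul (s.subst f) (t.subst f)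

end Term

/-- The substitution `[t / x]`. -/
def sub₁ (t : Term) (x : ℕ) : ℕ → Term :=
  fun z => if z = x then t else Term.var z

/-- The simultaneous substitution `[s / x, t / y]` (used for `x ≠ y` only). -/
def sub₂ (s : Term) (x : ℕ) (t : Term) (y : ℕ) : ℕ → Term :=
  fun z => if z = x then s else if z = y then t else Term.var z

namespace Form

/-- Free variables. -/
def fv : Form → Finset ℕ
  | eq s t => s.fv ∪ t.fv
  | lt s t => s.fv ∪ t.fv
  | bot => ∅
  | and φ ψ => φ.fv ∪ ψ.fv
  | or φ ψ => φ.fv ∪ ψ.fv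
  | imp φ ψ => φ.fv ∪ ψ.fv
  | all x φ => φ.fv.erase x
  | ex x φ => φ.fv.erase x

/-- Bound variables. -/
def bv : Form → Finset ℕ
  | eq _ _ => ∅
  | lt _ _ => ∅
  | bot => ∅
  | and φ ψ => φ.bv ∪ ψ.bv
  | or φ ψ => φ.bv ∪ ψ.bv
  | imp φ ψ => φ.bv ∪ ψ.bv
  | all x φ => insert x φ.bv
  | ex x φ => insert x φ.bv

/-- Replacement of the free occurrences of variables. The rules below use `φ.subst f` only
together with the condition `Subst1Ok` or `Subst2Ok`, which excludes capture. -/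
def subst (f : ℕ → Term) : Form → Form
  | eq s t => eq (s.subst f) (t.subst f)
  | lt s t => lt (s.subst f) (t.subst f)
  | bot => bot
  | and φ ψ => and (φ.subst f) (ψ.subst f)
  | or φ ψ => or (φ.subst f) (ψ.subst f)
  | imp φ ψ => imp (φ.subst f) (ψ.subst f)
  | all x φ => all x (φ.subst (Function.update f x (Term.var x)))
  | ex x φ => ex x (φ.subst (Function.update f x (Term.var x)))

/-- `φ[t / x]` is defined: no free variable of `t` is a bound variable of `φ`. -/
def Subst1Ok (φ : Form) (t : Term) : Prop := Disjoint t.fv φ.bv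

/-- `φ[s / x, t / y]` is defined. -/
def Subst2Ok (φ : Form) (s t : Term) : Prop := Disjoint s.fv φ.bv ∧ Disjoint t.fv φ.bv

/-- The terms with a free occurrence in the formula (an occurrence, possibly as a subterm, none
of whose variables is bound at that place). -/
def terms : Form → Finset Term
  | eq s t => s.subterms ∪ t.subterms
  | lt s t => s.subterms ∪ t.subterms
  | bot => ∅
  | and φ ψ => φ.terms ∪ ψ.terms
  | or φ ψ => φ.terms ∪ ψ.terms
  | imp φ ψ => φ.terms ∪ ψ.terms
  | all x φ => φ.terms.filter (fun t => x ∉ t.fv)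
  | ex x φ => φ.terms.filter (fun t => x ∉ t.fv)

end Form

/-! ### Sequents and the rules of cyclic arithmetic -/

/-- Sequents `Γ ⇒ Δ` of finite sets of formulas. -/
@[ext]
structure CASeq where
  antecedent : Finset Form
  succedent : Finset Form
  deriving DecidableEq

infix:50 " ⟹ " => CASeq.mk

/-- `Term(Γ ⇒ Δ)`. -/
def CASeq.terms (S : CASeq) : Finset Term :=
  S.antecedent.biUnion Form.terms ∪ S.succedent.biUnion Form.terms

/-- `FV(Γ, Δ)`. -/
def fvs (Γ Δ : Finset Form) : Finset ℕ := Γ.biUnion Form.fv ∪ Δ.biUnion Form.fv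

/-- `Γ[f]`. -/
def substs (f : ℕ → Term) (Γ : Finset Form) : Finset Form := Γ.image (Form.subst f)

open Term Form

/-- The axioms of arithmetic. -/
inductive ArithAx : CASeq → Prop
  | lt_trans (s t u : Term) : ArithAx ({lt s t, lt t u} ⟹ {lt s u})
  | lt_asymm (s t : Term) : ArithAx ({lt s t, lt t s} ⟹ ∅)
  | lt_succ_discrete (s t : Term) : ArithAx ({lt s t, lt t (succ s)} ⟹ ∅)
  | not_lt_zero (t : Term) : ArithAx ({lt t zero} ⟹ ∅)
  | succ_lt_succ (s t : Term) : ArithAx ({lt s t} ⟹ {lt (succ s) (succ t)})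
  | trichotomy (s t : Term) : ArithAx (∅ ⟹ {lt s t, eq s t, lt t s})
  | lt_succ (t : Term) : ArithAx (∅ ⟹ {lt t (succ t)})
  | add_zero (t : Term) : ArithAx (∅ ⟹ {eq (add t zero) t})
  | add_succ (s t : Term) : ArithAx (∅ ⟹ {eq (add s (succ t)) (succ (add s t))})
  | mul_zero (t : Term) : ArithAx (∅ ⟹ {eq (mul t zero) zero})
  | mul_succ (s t : Term) : ArithAx (∅ ⟹ {eq (mul s (succ t)) (add (mul s t) s)})

/-- `CAStep C [P₁, …, Pₙ]`: there is an instance of a derivation rule of cyclic arithmetic with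
conclusion `C` and premises `P₁, …, Pₙ`. -/
inductive CAStep : CASeq → List CASeq → Prop
  | ax (Γ Δ : Finset Form) (φ : Form) : CAStep (insert φ Γ ⟹ insert φ Δ) []
  | botL (Γ Δ : Finset Form) : CAStep (insert bot Γ ⟹ Δ) []
  | impL (Γ Δ : Finset Form) (φ ψ : Form) :
      CAStep (insert (imp φ ψ) Γ ⟹ Δ) [insert ψ Γ ⟹ Δ, Γ ⟹ insert φ Δ]
  | impR (Γ Δ : Finset Form) (φ ψ : Form) :
      CAStep (Γ ⟹ insert (imp φ ψ) Δ) [insert φ Γ ⟹ insert ψ Δ]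
  | andL (Γ Δ : Finset Form) (φ ψ : Form) :
      CAStep (insert (and φ ψ) Γ ⟹ Δ) [insert φ (insert ψ Γ) ⟹ Δ]
  | andR (Γ Δ : Finset Form) (φ ψ : Form) :
      CAStep (Γ ⟹ insert (and φ ψ) Δ) [Γ ⟹ insert φ Δ, Γ ⟹ insert ψ Δ]
  | orL (Γ Δ : Finset Form) (φ ψ : Form) :
      CAStep (insert (or φ ψ) Γ ⟹ Δ) [insert φ Γ ⟹ Δ, insert ψ Γ ⟹ Δ]
  | orR (Γ Δ : Finset Form) (φ ψ : Form) :
      CAStep (Γ ⟹ insert (or φ ψ) Δ) [Γ ⟹ insert φ (insert ψ Δ)]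
  | allL (Γ Δ : Finset Form) (x : ℕ) (φ : Form) (t : Term) (h : φ.Subst1Ok t) :
      CAStep (insert (all x φ) Γ ⟹ Δ) [insert (φ.subst (sub₁ t x)) Γ ⟹ Δ]
  | allR (Γ Δ : Finset Form) (x : ℕ) (φ : Form) (h : x ∉ fvs Γ Δ) :
      CAStep (Γ ⟹ insert (all x φ) Δ) [Γ ⟹ insert φ Δ]
  | exL (Γ Δ : Finset Form) (x : ℕ) (φ : Form) (h : x ∉ fvs Γ Δ) :
      CAStep (insert (ex x φ) Γ ⟹ Δ) [insert φ Γ ⟹ Δ]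
  | exR (Γ Δ : Finset Form) (x : ℕ) (φ : Form) (t : Term) (h : φ.Subst1Ok t) :
      CAStep (Γ ⟹ insert (ex x φ) Δ) [Γ ⟹ insert (φ.subst (sub₁ t x)) Δ]
  | eqL (Γ Δ : Finset Form) (s t : Term) (x y : ℕ) (hxy : x ≠ y)
      (hx : x ∉ s.fv ∪ t.fv) (hy : y ∉ s.fv ∪ t.fv) (hd : ∀ φ ∈ Γ ∪ Δ, φ.Subst2Ok s t) :
      CAStep (insert (eq s t) (substs (sub₂ s x t y) Γ) ⟹ substs (sub₂ s x t y) Δ)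
        [substs (sub₂ t x s y) Γ ⟹ substs (sub₂ t x s y) Δ]
  | eqR (Γ Δ : Finset Form) (t : Term) : CAStep (Γ ⟹ insert (eq t t) Δ) []
  | wk (Γ Γ' Δ Δ' : Finset Form) : CAStep (Γ ∪ Γ' ⟹ Δ ∪ Δ') [Γ ⟹ Δ]
  | cut (Γ Δ : Finset Form) (φ : Form) : CAStep (Γ ⟹ Δ) [insert φ Γ ⟹ Δ, Γ ⟹ insert φ Δ]
  | sub (Γ Δ : Finset Form) (s : Term) (x : ℕ) (hd : ∀ φ ∈ Γ ∪ Δ, φ.Subst1Ok s) :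
      CAStep (substs (sub₁ s x) Γ ⟹ substs (sub₁ s x) Δ) [Γ ⟹ Δ]
  | arith (S : CASeq) (h : ArithAx S) : CAStep S []
  | succCase (Γ Δ : Finset Form) (t : Term) (x : ℕ) (h : x ∉ fvs Γ Δ ∪ t.fv) :
      CAStep (insert (lt zero t) Γ ⟹ Δ) [insert (eq t (succ (var x))) Γ ⟹ Δ]

/-! ### Derivation systems and cyclic preproofs -/

structure DerivationSystem where
  Seq : Type
  /-- The rule instances. -/
  Rule : Type
  concl : Rule → Seq
  prems : Rule → List Seq

/-- A finite tree of words over `ℕ` with a partial map `back` from leaves (the buds) to proper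
prefixes that are inner nodes (their companions). -/
structure CyclicTree where
  nodes : Finset (List ℕ)
  root_mem : [] ∈ nodes
  prefix_mem : ∀ t i, t ++ [i] ∈ nodes → t ∈ nodes
  back : List ℕ → Option (List ℕ)
  back_leaf : ∀ t c, back t = some c → t ∈ nodes ∧ ∀ i, t ++ [i] ∉ nodes
  back_inner : ∀ t c, back t = some c → c ∈ nodes ∧ ∃ i, c ++ [i] ∈ nodes
  back_lt : ∀ t c, back t = some c → c <+: t ∧ c ≠ t

/-- `t` is a leaf. -/
def CyclicTree.IsLeaf (C : CyclicTree) (t : List ℕ) : Prop :=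
  t ∈ C.nodes ∧ ∀ i, t ++ [i] ∉ C.nodes

/-- Preproofs. Only the values of `lab` on the nodes matter. The children of a node labelled with
an `n`-premise rule are `t1, …, tn`. -/
structure Preproof (D : DerivationSystem) extends CyclicTree where
  lab : List ℕ → D.Seq
  lab_back : ∀ t c, back t = some c → lab t = lab c
  rule : List ℕ → Option D.Rule
  rule_dom : ∀ t R, rule t = some R → t ∈ nodes ∧ back t = none
  rule_concl : ∀ t R, rule t = some R → D.concl R = lab t
  rule_children : ∀ t R, rule t = some R →
    ∀ i, t ++ [i] ∈ nodes ↔ 1 ≤ i ∧ i ≤ (D.prems R).length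
  rule_prems : ∀ t R, rule t = some R →
    ∀ (i : ℕ) (h : i < (D.prems R).length), lab (t ++ [i + 1]) = (D.prems R)[i]
  rule_or_leaf : ∀ t ∈ nodes, back t = none → rule t = none → ∀ i, t ++ [i] ∉ nodes

namespace Preproof

variable {D : DerivationSystem}

/-- No assumptions: every leaf that is not a bud carries a rule (without premises). -/
def Closed (P : Preproof D) : Prop :=
  ∀ t, P.IsLeaf t → P.back t = none → P.rule t ≠ none

def endseq (P : Preproof D) : D.Seq := P.lab []

/-- No buds. -/
def Acyclic (P : Preproof D) : Prop := ∀ t, P.back t = none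

end Preproof

/-! ### Peano arithmetic -/

/-- `(∀x. (∀y. y < x → φ[y / x]) → φ) → ∀x. φ`. -/
def inductionFormula (x y : ℕ) (φ : Form) : Form :=
  imp
    (all x (imp (all y (imp (lt (var y) (var x)) (φ.subst (sub₁ (var y) x)))) φ))
    (all x φ)

/-- The rules of cyclic arithmetic together with the induction scheme. -/
inductive PAStep : CASeq → List CASeq → Prop
  | ca (S : CASeq) (L : List CASeq) (h : CAStep S L) : PAStep S L
  | ind (x y : ℕ) (φ : Form) (hxy : y ≠ x) (hf : y ∉ φ.fv) (hd : φ.Subst1Ok (var y)) :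
      PAStep (∅ ⟹ {inductionFormula x y φ}) []

abbrev PASystem : DerivationSystem where
  Seq := CASeq
  Rule := {r : CASeq × List CASeq // PAStep r.1 r.2}
  concl r := r.1.1
  prems r := r.1.2

/-- `PA ⊢ Γ ⇒ Δ`: there is a non-cyclic preproof without assumptions. -/
def PAProves (S : CASeq) : Prop :=
  ∃ P : Preproof PASystem, P.Closed ∧ P.Acyclic ∧ P.endseq = S

/-! ### Reset arithmetic -/

/-- Finite sets of assignments `t ↦ u`; letters are natural numbers. -/
abbrev Assignments := Finset (Term × List ℕ)

/-- Expressions `Θ ; σ | Γ ⇒ Δ`. -/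
@[ext]
structure RAExpr where
  ctrl : List ℕ
  asg : Assignments
  seq : CASeq
  deriving DecidableEq

/-- The conditions on an expression `Θ ; σ | Γ ⇒ Δ` to be a sequent of reset arithmetic. -/
def RAExpr.IsSequent (S : RAExpr) : Prop :=
  S.ctrl.Nodup ∧ ∀ p ∈ S.asg, p.1 ∈ S.seq.terms ∧ p.2.Sublist S.ctrl

abbrev RASeq := {S : RAExpr // S.IsSequent}

/-- `Θ` without the letters that `σ` does not assign to any term. -/
def pruneCtrl (Θ : List ℕ) (σ : Assignments) : List ℕ :=
  Θ.filter (fun a => decide (∃ p ∈ σ, a ∈ p.2))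

/-- `Θ' ; σ' | S`: first remove the assignments to terms that do not occur in `S`, then the
letters that are no longer assigned to any term. -/
def primed (Θ : List ℕ) (σ : Assignments) (S : CASeq) : RAExpr :=
  let σ' := σ.filter (fun p => p.1 ∈ S.terms)
  ⟨pruneCtrl Θ σ', σ', S⟩

/-- `σ[f]`. -/
def substAsg (f : ℕ → Term) (σ : Assignments) : Assignments :=
  σ.image (fun p => (p.1.subst f, p.2))

/-- `reset a` marks the instances of `Reset_a`, `ordinary` those of all other rules. -/
inductive RuleKind : Type
  | ordinary
  | reset (a : ℕ)

/-- `RAStep k C [P₁, …, Pₙ]`: there is an instance, of kind `k`, of a derivation rule of reset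
arithmetic with conclusion `C` and premises `P₁, …, Pₙ`. -/
inductive RAStep : RuleKind → RAExpr → List RAExpr → Prop
  | ax (Θ : List ℕ) (σ : Assignments) (Γ Δ : Finset Form) (φ : Form) :
      RAStep .ordinary ⟨Θ, σ, insert φ Γ ⟹ insert φ Δ⟩ []
  | botL (Θ : List ℕ) (σ : Assignments) (Γ Δ : Finset Form) :
      RAStep .ordinary ⟨Θ, σ, insert bot Γ ⟹ Δ⟩ []
  | impL (Θ : List ℕ) (σ : Assignments) (Γ Δ : Finset Form) (φ ψ : Form) :
      RAStep .ordinary ⟨Θ, σ, insert (imp φ ψ) Γ ⟹ Δ⟩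
        [primed Θ σ (insert ψ Γ ⟹ Δ), primed Θ σ (Γ ⟹ insert φ Δ)]
  | impR (Θ : List ℕ) (σ : Assignments) (Γ Δ : Finset Form) (φ ψ : Form) :
      RAStep .ordinary ⟨Θ, σ, Γ ⟹ insert (imp φ ψ) Δ⟩ [⟨Θ, σ, insert φ Γ ⟹ insert ψ Δ⟩]
  | andL (Θ : List ℕ) (σ : Assignments) (Γ Δ : Finset Form) (φ ψ : Form) :
      RAStep .ordinary ⟨Θ, σ, insert (and φ ψ) Γ ⟹ Δ⟩ [⟨Θ, σ, insert φ (insert ψ Γ) ⟹ Δ⟩]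
  | andR (Θ : List ℕ) (σ : Assignments) (Γ Δ : Finset Form) (φ ψ : Form) :
      RAStep .ordinary ⟨Θ, σ, Γ ⟹ insert (and φ ψ) Δ⟩
        [primed Θ σ (Γ ⟹ insert φ Δ), primed Θ σ (Γ ⟹ insert ψ Δ)]
  | orL (Θ : List ℕ) (σ : Assignments) (Γ Δ : Finset Form) (φ ψ : Form) :
      RAStep .ordinary ⟨Θ, σ, insert (or φ ψ) Γ ⟹ Δ⟩
        [primed Θ σ (insert φ Γ ⟹ Δ), primed Θ σ (insert ψ Γ ⟹ Δ)]
  | orR (Θ : List ℕ) (σ : Assignments) (Γ Δ : Finset Form) (φ ψ : Form) :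
      RAStep .ordinary ⟨Θ, σ, Γ ⟹ insert (or φ ψ) Δ⟩ [⟨Θ, σ, Γ ⟹ insert φ (insert ψ Δ)⟩]
  | allL (Θ : List ℕ) (σ : Assignments) (Γ Δ : Finset Form) (x : ℕ) (φ : Form) (t : Term)
      (h : φ.Subst1Ok t) :
      RAStep .ordinary ⟨Θ, σ, insert (all x φ) Γ ⟹ Δ⟩
        [⟨Θ, σ, insert (φ.subst (sub₁ t x)) Γ ⟹ Δ⟩]
  | allR (Θ : List ℕ) (σ : Assignments) (Γ Δ : Finset Form) (x : ℕ) (φ : Form)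
      (h : x ∉ fvs Γ Δ) :
      RAStep .ordinary ⟨Θ, σ, Γ ⟹ insert (all x φ) Δ⟩ [⟨Θ, σ, Γ ⟹ insert φ Δ⟩]
  | exL (Θ : List ℕ) (σ : Assignments) (Γ Δ : Finset Form) (x : ℕ) (φ : Form)
      (h : x ∉ fvs Γ Δ) :
      RAStep .ordinary ⟨Θ, σ, insert (ex x φ) Γ ⟹ Δ⟩ [⟨Θ, σ, insert φ Γ ⟹ Δ⟩]
  | exR (Θ : List ℕ) (σ : Assignments) (Γ Δ : Finset Form) (x : ℕ) (φ : Form) (t : Term)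
      (h : φ.Subst1Ok t) :
      RAStep .ordinary ⟨Θ, σ, Γ ⟹ insert (ex x φ) Δ⟩
        [primed Θ σ (Γ ⟹ insert (φ.subst (sub₁ t x)) Δ)]
  | eqL (Θ : List ℕ) (σ : Assignments) (Γ Δ : Finset Form) (s t : Term) (x y : ℕ) (hxy : x ≠ y)
      (hx : x ∉ s.fv ∪ t.fv) (hy : y ∉ s.fv ∪ t.fv) (hd : ∀ φ ∈ Γ ∪ Δ, φ.Subst2Ok s t) :
      RAStep .ordinary
        ⟨Θ, substAsg (sub₂ s x t y) σ,
          insert (eq s t) (substs (sub₂ s x t y) Γ) ⟹ substs (sub₂ s x t y) Δ⟩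
        [⟨Θ, substAsg (sub₂ t x s y) σ,
          substs (sub₂ t x s y) Γ ⟹ substs (sub₂ t x s y) Δ⟩]
  | eqR (Θ : List ℕ) (σ : Assignments) (Γ Δ : Finset Form) (t : Term) :
      RAStep .ordinary ⟨Θ, σ, Γ ⟹ insert (eq t t) Δ⟩ []
  | wk (Θ : List ℕ) (σ σ' : Assignments) (Γ Γ' Δ Δ' : Finset Form) :
      RAStep .ordinary ⟨Θ, σ ∪ σ', Γ ∪ Γ' ⟹ Δ ∪ Δ'⟩ [⟨pruneCtrl Θ σ, σ, Γ ⟹ Δ⟩]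
  | cut (Θ : List ℕ) (σ : Assignments) (Γ Δ : Finset Form) (φ : Form) :
      RAStep .ordinary ⟨Θ, σ, Γ ⟹ Δ⟩ [⟨Θ, σ, insert φ Γ ⟹ Δ⟩, ⟨Θ, σ, Γ ⟹ insert φ Δ⟩]
  | sub (Θ : List ℕ) (σ : Assignments) (Γ Δ : Finset Form) (s : Term) (x : ℕ)
      (hd : ∀ φ ∈ Γ ∪ Δ, φ.Subst1Ok s) :
      RAStep .ordinary ⟨Θ, substAsg (sub₁ s x) σ, substs (sub₁ s x) Γ ⟹ substs (sub₁ s x) Δ⟩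
        [⟨Θ, σ, Γ ⟹ Δ⟩]
  | arith (Θ : List ℕ) (σ : Assignments) (S : CASeq) (h : ArithAx S) :
      RAStep .ordinary ⟨Θ, σ, S⟩ []
  | succCase (Θ : List ℕ) (σ : Assignments) (Γ Δ : Finset Form) (t : Term) (x : ℕ)
      (h : x ∉ fvs Γ Δ ∪ t.fv) :
      RAStep .ordinary ⟨Θ, σ, insert (lt zero t) Γ ⟹ Δ⟩
        [⟨Θ, σ, insert (eq t (succ (var x))) Γ ⟹ Δ⟩]
  | focus (Θ : List ℕ) (σ : Assignments) (S : CASeq) (t : Term) (h : t ∈ S.terms) :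
      RAStep .ordinary ⟨Θ, σ, S⟩ [⟨Θ, insert (t, []) σ, S⟩]
  | ltL (Θ : List ℕ) (σ : Assignments) (Γ Δ : Finset Form) (s t : Term) (u : List ℕ) (a : ℕ)
      (h : a ∉ Θ) :
      RAStep .ordinary ⟨Θ, insert (t, u) σ, insert (lt s t) Γ ⟹ Δ⟩
        [⟨Θ ++ [a], insert (s, u ++ [a]) σ, Γ ⟹ Δ⟩]
  /- `τ` is the set of the pairs `(t₁, u₁), …, (tₙ, uₙ)`. -/
  | reset (Θ : List ℕ) (σ : Assignments) (S : CASeq) (u : List ℕ) (a : ℕ) (τ : Assignments)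
      (hne : τ.Nonempty) (hcov : ∀ p ∈ τ, p.2 ≠ []) (h : ∀ p ∈ σ, a ∉ p.2) :
      RAStep (.reset a)
        ⟨Θ, σ ∪ τ.image (fun p => (p.1, u ++ a :: p.2)), S⟩
        [⟨pruneCtrl Θ (σ ∪ τ.image (fun p => (p.1, u ++ [a]))),
          σ ∪ τ.image (fun p => (p.1, u ++ [a])), S⟩]

structure RARule where
  kind : RuleKind
  concl : RASeq
  prems : List RASeq
  step : RAStep kind concl.1 (prems.map Subtype.val)

abbrev RASystem : DerivationSystem where
  Seq := RASeq
  Rule := RARule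
  concl := RARule.concl
  prems := RARule.prems

/-- The letter `a` is an invariant of the bud `t` with companion `c`: on the whole path from `c`
to `t` it occurs in the control, preceded by the same word `w`, and `Reset_a` is applied there. -/
def IsInvariant (P : Preproof RASystem) (t c : List ℕ) (a : ℕ) : Prop :=
  (∃ w : List ℕ, ∀ s, c <+: s → s <+: t → ∃ v, (P.lab s).1.ctrl = w ++ a :: v) ∧
  ∃ s R, c <+: s ∧ s <+: t ∧ P.rule s = some R ∧ RARule.kind R = .reset a

/-- The soundness condition of reset arithmetic. -/
def RASound (P : Preproof RASystem) : Prop :=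
  ∀ t c, P.back t = some c → ∃ a, IsInvariant P t c a

/-- The sequent `ε ; ∅ | Γ ⇒ Δ`. -/
def RASeq.ofCA (S : CASeq) : RASeq := ⟨⟨[], ∅, S⟩, List.nodup_nil, by simp⟩

/-- `RA ⊢ Γ ⇒ Δ`. -/
def RAProves (S : CASeq) : Prop :=
  ∃ P : Preproof RASystem, P.Closed ∧ RASound P ∧ P.endseq = RASeq.ofCA S

end ResetArithmetic

/-! Every rule of `CAStep` is a rule of reset arithmetic with empty control and no assignments, so a
PA proof is translated node by node. All that remains is to derive each induction axiom, and one
cycle suffices.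

Let `Γ` be the progressiveness assumption, suppose `Γ, ∀w (w < z → A[w/z]) ⇒ A` is provable, and let
`v` be fresh. The companion is `z < v, Γ ⇒ A` with `z ↦ 0`. A cut with `∀w (w < z → A[w/z])` leaves
the given sequent on one side and, after the right rules, `w < z, z < v, Γ ⇒ A[w/z], A` on the
other. There `<L` gives `w ↦ 01`, `Reset_0` shortens this to `w ↦ 0`, and after weakening the
sequent is the companion with `w` for `z` and `z` for `v`; two instances of `Sub` return to it. The
letter 0 heads every control of the cycle, so it is an invariant: one trip around the loop is one
descent from `z` to a smaller `w`. Below the companion, `Focus` and `<L` create the letter, and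
putting `S z` for `v` lets the axiom `z < S z` remove the extra hypothesis (`RAProves.induction`).

The second difficulty is naming. The cycle needs a variable that is bound nowhere in its sequents,
whereas `x` is bound in the induction hypothesis and possibly in `φ`. The cycle therefore proves
`φ[z/x]` for a fresh `z`, and `φ` is recovered from `z = x` by replacement of equals under binders
(`RAProves.congr`), the equation being supplied by `∃z. z = x` (`RAProves.of_fresh_eq`). -/

namespace ResetArithmetic

/-! ### Assembling preproofs: grafting under a rule and closing a cycle -/

namespace Preproof

variable {D : DerivationSystem}

/-- The preproof that consists of a single assumption. -/
def leaf (D : DerivationSystem) (s : D.Seq) : Preproof D where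
  nodes := {[]}
  root_mem := by simp
  prefix_mem := by simp
  back _ := none
  back_leaf := by simp
  back_inner := by simp
  back_lt := by simp
  lab _ := s
  lab_back := by simp
  rule _ := none
  rule_dom := by simp
  rule_concl := by simp
  rule_children := by simp
  rule_prems := by simp
  rule_or_leaf := by simp

/-- `t` is a leaf that is neither a bud nor the conclusion of a rule. -/
def Assumption (P : Preproof D) (t : List ℕ) : Prop :=
  P.IsLeaf t ∧ P.back t = none ∧ P.rule t = none

theorem closed_iff (P : Preproof D) : P.Closed ↔ ∀ t, ¬ P.Assumption t := by
  simp only [Closed, Assumption, not_and]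

/-- The nodes of a tree with the immediate subtrees `Q 0, …, Q (n - 1)`. -/
def graftNodes (n : ℕ) (Q : ℕ → Preproof D) : Finset (List ℕ) :=
  insert [] ((Finset.range n).biUnion fun i => (Q i).nodes.image (List.cons (i + 1)))

def graftBack (n : ℕ) (Q : ℕ → Preproof D) : List ℕ → Option (List ℕ)
  | (i + 1) :: t => if i < n then ((Q i).back t).map (List.cons (i + 1)) else none
  | _ => none

def graftLab (s : D.Seq) (Q : ℕ → Preproof D) : List ℕ → D.Seq
  | (i + 1) :: t => (Q i).lab t
  | _ => s

def graftRule (R : D.Rule) (n : ℕ) (Q : ℕ → Preproof D) : List ℕ → Option D.Rule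
  | [] => some R
  | (i + 1) :: t => if i < n then (Q i).rule t else none
  | 0 :: _ => none

variable {n : ℕ} {Q : ℕ → Preproof D} {R : D.Rule} {s : D.Seq}

theorem nil_mem_graftNodes : [] ∈ graftNodes n Q := by simp [graftNodes]

theorem cons_mem_graftNodes {j : ℕ} {t : List ℕ} :
    j :: t ∈ graftNodes n Q ↔ ∃ i < n, j = i + 1 ∧ t ∈ (Q i).nodes := by
  simp only [graftNodes, Finset.mem_insert, Finset.mem_biUnion, Finset.mem_range,
    Finset.mem_image, List.cons.injEq, reduceCtorEq, false_or]
  constructor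
  · rintro ⟨i, hi, t', ht', rfl, rfl⟩
    exact ⟨i, hi, rfl, ht'⟩
  · rintro ⟨i, hi, rfl, ht⟩
    exact ⟨i, hi, t, ht, rfl, rfl⟩

theorem succ_cons_mem_graftNodes {i : ℕ} {t : List ℕ} :
    (i + 1) :: t ∈ graftNodes n Q ↔ i < n ∧ t ∈ (Q i).nodes := by
  rw [cons_mem_graftNodes]
  constructor
  · rintro ⟨j, hj, h, ht⟩
    obtain rfl : i = j := by omega
    exact ⟨hj, ht⟩
  · rintro ⟨hi, ht⟩
    exact ⟨i, hi, rfl, ht⟩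

theorem graftBack_eq_some {t c : List ℕ} :
    graftBack n Q t = some c ↔
      ∃ i < n, ∃ t' c', t = (i + 1) :: t' ∧ c = (i + 1) :: c' ∧ (Q i).back t' = some c' := by
  constructor
  · intro h
    match t, h with
    | (i + 1) :: t', h =>
      simp only [graftBack] at h
      split_ifs at h with hi
      obtain ⟨c', hc', rfl⟩ := Option.map_eq_some_iff.1 h
      exact ⟨i, hi, t', c', rfl, rfl, hc'⟩
  · rintro ⟨i, hi, t', c', rfl, rfl, h⟩
    simp [graftBack, hi, h]

theorem graftRule_eq_some {t : List ℕ} {R' : D.Rule} :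
    graftRule R n Q t = some R' ↔
      (t = [] ∧ R' = R) ∨ ∃ i < n, ∃ t', t = (i + 1) :: t' ∧ (Q i).rule t' = some R' := by
  constructor
  · intro h
    match t, h with
    | [], h => exact Or.inl ⟨rfl, by simpa [graftRule, eq_comm] using h⟩
    | (i + 1) :: t', h =>
      simp only [graftRule] at h
      split_ifs at h with hi
      exact Or.inr ⟨i, hi, t', rfl, h⟩
  · rintro (⟨rfl, rfl⟩ | ⟨i, hi, t', rfl, h⟩)
    · rfl
    · simp [graftRule, hi, h]

/-- The preproof with the last rule `R` and the immediate subproofs `Q 0, Q 1, …`. -/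
def graft (R : D.Rule) (Q : ℕ → Preproof D)
    (hQ : ∀ (i : ℕ) (h : i < (D.prems R).length), (Q i).lab [] = (D.prems R)[i]) :
    Preproof D where
  nodes := graftNodes (D.prems R).length Q
  root_mem := nil_mem_graftNodes
  prefix_mem := by
    rintro (_ | ⟨j, t⟩) i h
    · exact nil_mem_graftNodes
    · rw [List.cons_append, cons_mem_graftNodes] at h
      obtain ⟨k, hk, rfl, ht⟩ := h
      exact succ_cons_mem_graftNodes.2 ⟨hk, (Q k).prefix_mem _ _ ht⟩
  back := graftBack (D.prems R).length Q
  back_leaf t c h := by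
    obtain ⟨i, hi, t, c, rfl, rfl, hb⟩ := graftBack_eq_some.1 h
    have := (Q i).back_leaf t c hb
    simpa [succ_cons_mem_graftNodes, hi] using this
  back_inner t c h := by
    obtain ⟨i, hi, t, c, rfl, rfl, hb⟩ := graftBack_eq_some.1 h
    have := (Q i).back_inner t c hb
    simpa [succ_cons_mem_graftNodes, hi] using this
  back_lt t c h := by
    obtain ⟨i, hi, t, c, rfl, rfl, hb⟩ := graftBack_eq_some.1 h
    simpa using (Q i).back_lt t c hb
  lab := graftLab (D.concl R) Q
  lab_back t c h := by
    obtain ⟨i, hi, t, c, rfl, rfl, hb⟩ := graftBack_eq_some.1 h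
    exact (Q i).lab_back t c hb
  rule := graftRule R (D.prems R).length Q
  rule_dom t R' h := by
    obtain ⟨rfl, rfl⟩ | ⟨i, hi, t, rfl, hr⟩ := graftRule_eq_some.1 h
    · exact ⟨nil_mem_graftNodes, rfl⟩
    · have := (Q i).rule_dom t R' hr
      exact ⟨succ_cons_mem_graftNodes.2 ⟨hi, this.1⟩, by simp [graftBack, this.2]⟩
  rule_concl t R' h := by
    obtain ⟨rfl, rfl⟩ | ⟨i, hi, t, rfl, hr⟩ := graftRule_eq_some.1 h
    · rfl
    · exact (Q i).rule_concl t R' hr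
  rule_children t R' h j := by
    obtain ⟨rfl, rfl⟩ | ⟨i, hi, t, rfl, hr⟩ := graftRule_eq_some.1 h
    · rw [List.nil_append, cons_mem_graftNodes]
      constructor
      · rintro ⟨i, hi, rfl, -⟩
        omega
      · rintro ⟨h1, h2⟩
        -- Children are numbered from 1, the subproofs from 0.
        exact ⟨j - 1, by omega, by omega, (Q _).root_mem⟩
    · rw [List.cons_append, succ_cons_mem_graftNodes, (Q i).rule_children t R' hr j]
      simp [hi]
  rule_prems t R' h j hj := by
    obtain ⟨rfl, rfl⟩ | ⟨i, hi, t, rfl, hr⟩ := graftRule_eq_some.1 h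
    · exact hQ j hj
    · exact (Q i).rule_prems t R' hr j hj
  rule_or_leaf := by
    rintro (_ | ⟨j, t⟩) ht hb hr i
    · simp [graftRule] at hr
    · obtain ⟨k, hk, rfl, ht'⟩ := cons_mem_graftNodes.1 ht
      rw [List.cons_append, succ_cons_mem_graftNodes]
      rintro ⟨-, h⟩
      refine (Q k).rule_or_leaf t ht' ?_ ?_ i h
      · simpa [graftBack, hk] using hb
      · simpa [graftRule, hk] using hr

theorem graft_assumption
    {hQ : ∀ (i : ℕ) (h : i < (D.prems R).length), (Q i).lab [] = (D.prems R)[i]} {t : List ℕ} :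
    (graft R Q hQ).Assumption t ↔
      ∃ i < (D.prems R).length, ∃ t', t = (i + 1) :: t' ∧ (Q i).Assumption t' := by
  constructor
  · rintro ⟨⟨ht, hl⟩, hb, hr⟩
    obtain _ | ⟨j, t⟩ := t
    · simp [graft, graftRule] at hr
    · obtain ⟨i, hi, rfl, ht'⟩ := cons_mem_graftNodes.1 ht
      refine ⟨i, hi, t, rfl, ⟨ht', fun k hk => hl k ?_⟩, ?_, ?_⟩
      · exact succ_cons_mem_graftNodes.2 ⟨hi, hk⟩
      · simpa [graft, graftBack, hi] using hb
      · simpa [graft, graftRule, hi] using hr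
  · rintro ⟨i, hi, t, rfl, ⟨ht, hl⟩, hb, hr⟩
    refine ⟨⟨succ_cons_mem_graftNodes.2 ⟨hi, ht⟩, fun k hk => hl k ?_⟩, ?_, ?_⟩
    · exact (succ_cons_mem_graftNodes.1 hk).2
    · simp [graft, graftBack, hb]
    · simp [graft, graftRule, hr]

/-- Turn the assumption `p` into a bud whose companion is the root. -/
def closeLoop (P : Preproof D) (p : List ℕ) (hp : P.Assumption p) (hne : p ≠ [])
    (hlab : P.lab p = P.lab []) : Preproof D where
  nodes := P.nodes
  root_mem := P.root_mem
  prefix_mem := P.prefix_mem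
  back := Function.update P.back p (some [])
  back_leaf t c h := by
    by_cases htp : t = p
    · subst htp
      exact hp.1
    · exact P.back_leaf t c (by simpa [htp] using h)
  back_inner t c h := by
    by_cases htp : t = p
    · subst htp
      obtain rfl : [] = c := by simpa using h
      refine ⟨P.root_mem, ?_⟩
      -- The companion must be an inner node: by closure under prefixes, the first edge on the way
      -- to `p` ends in a child of the root.
      have key : ∀ (l : List ℕ) (i : ℕ), i :: l ∈ P.nodes → [i] ∈ P.nodes := by
        intro l
        induction l using List.reverseRecOn with
        | nil => simp
        | append_singleton l j ih =>
          intro i h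
          exact ih i (P.prefix_mem _ j (by simpa using h))
      obtain ⟨i, l, rfl⟩ := List.exists_cons_of_ne_nil hne
      exact ⟨i, key l i hp.1.1⟩
    · exact P.back_inner t c (by simpa [htp] using h)
  back_lt t c h := by
    by_cases htp : t = p
    · subst htp
      obtain rfl : [] = c := by simpa using h
      exact ⟨List.nil_prefix, hne.symm⟩
    · exact P.back_lt t c (by simpa [htp] using h)
  lab := P.lab
  lab_back t c h := by
    by_cases htp : t = p
    · subst htp
      obtain rfl : [] = c := by simpa using h
      exact hlab
    · exact P.lab_back t c (by simpa [htp] using h)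
  rule := P.rule
  rule_dom t R h := by
    have htp : t ≠ p := by
      rintro rfl
      simp [hp.2.2] at h
    simpa [htp] using P.rule_dom t R h
  rule_concl := P.rule_concl
  rule_children := P.rule_children
  rule_prems := P.rule_prems
  rule_or_leaf t ht hb hr := by
    have htp : t ≠ p := by
      rintro rfl
      simp at hb
    exact P.rule_or_leaf t ht (by simpa [htp] using hb) hr

end Preproof

open Preproof

/-- The path from a companion to its bud stays within a single immediate subproof, so the old
invariant still serves. -/
theorem RASound.graft {R : RARule} {Q : ℕ → Preproof RASystem}
    {hQ : ∀ (i : ℕ) (h : i < (RASystem.prems R).length), (Q i).lab [] = (RASystem.prems R)[i]}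
    (h : ∀ i < R.prems.length, RASound (Q i)) : RASound (Preproof.graft R Q hQ) := by
  intro t c hb
  obtain ⟨i, hi, t, c, rfl, rfl, hb'⟩ := graftBack_eq_some.1 hb
  obtain ⟨a, ⟨w, hw⟩, s, R', hcs, hst, hR', hk⟩ := h i hi t c hb'
  refine ⟨a, ⟨w, fun s hcs hst => ?_⟩, (i + 1) :: s, R', ?_, ?_, ?_, hk⟩
  · obtain ⟨l, rfl⟩ := hcs
    exact hw (c ++ l) (List.prefix_append _ _) (by simpa using hst)
  · simpa using hcs
  · simpa using hst
  · exact (graftRule_eq_some (R := R)).2 (Or.inr ⟨i, hi, s, rfl, hR'⟩)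

/-- The sequent `e` is the root of a sound proof of reset arithmetic. -/
def RADerivable (e : RASeq) : Prop :=
  ∃ P : Preproof RASystem, P.Closed ∧ RASound P ∧ P.endseq = e

theorem RADerivable.of_rule (R : RARule) (h : ∀ e ∈ R.prems, RADerivable e) :
    RADerivable R.concl := by
  have h' : ∀ i, ∃ P : Preproof RASystem, ∀ hi : i < R.prems.length,
      P.Closed ∧ RASound P ∧ P.endseq = R.prems[i] := by
    intro i
    by_cases hi : i < R.prems.length
    · obtain ⟨P, hP⟩ := h R.prems[i] (List.getElem_mem hi)
      exact ⟨P, fun _ => hP⟩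
    · exact ⟨leaf _ R.concl, fun h => absurd h hi⟩
  choose Q hQ using h'
  refine ⟨graft (D := RASystem) R Q fun i hi => (hQ i hi).2.2, ?_,
    RASound.graft fun i hi => (hQ i hi).2.1, rfl⟩
  rw [closed_iff]
  intro t ht
  obtain ⟨i, hi, t, rfl, ht'⟩ := graft_assumption.1 ht
  exact (closed_iff _).1 (hQ i hi).1 t ht'

theorem RADerivable.step {k : RuleKind} {e : RASeq} (L : List RASeq)
    (hs : RAStep k e.1 (L.map Subtype.val)) (h : ∀ e' ∈ L, RADerivable e') : RADerivable e :=
  RADerivable.of_rule ⟨k, e, L, hs⟩ h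

/-- `e` is the root of a sound preproof with a single assumption, which is labelled `C`. All
controls on the branch to the assumption start with `w ++ [a]`; if `r` holds, then `Reset_a` is
applied on it. -/
def RABranch (w : List ℕ) (a : ℕ) (r : Prop) (C e : RASeq) : Prop :=
  ∃ (P : Preproof RASystem) (p : List ℕ), P.Assumption p ∧ (∀ t, P.Assumption t → t = p) ∧
    RASound P ∧ P.lab p = C ∧ P.endseq = e ∧
    (∀ s, s <+: p → ∃ v, (P.lab s).1.ctrl = w ++ a :: v) ∧
    (r → ∃ s R, s <+: p ∧ P.rule s = some R ∧ RARule.kind R = .reset a)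

variable {w : List ℕ} {a : ℕ} {r : Prop} {C : RASeq}

theorem RABranch.refl (h : ∃ v, C.1.ctrl = w ++ a :: v) : RABranch w a False C C :=
  ⟨leaf _ C, [], ⟨⟨by simp [leaf], by simp [leaf]⟩, rfl, rfl⟩,
    fun t ht => by simpa [leaf] using ht.1.1, fun t c hb => by simp [leaf] at hb, rfl, rfl,
    fun _ _ => h, False.elim⟩

/-- Prolongs the open branch downwards by one rule. Premises off the branch need complete proofs, so
that the assumption remains the only one. -/
theorem RABranch.of_rule (R : RARule) (i : ℕ) (hi : i < R.prems.length)
    (hb : RABranch w a r C R.prems[i])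
    (h : ∀ (j : ℕ) (hj : j < R.prems.length), j ≠ i → RADerivable R.prems[j])
    (hc : ∃ v, R.concl.1.ctrl = w ++ a :: v) :
    RABranch w a (r ∨ R.kind = .reset a) C R.concl := by
  obtain ⟨P, p, hp, hu, hsd, hC, he, hw, hr⟩ := hb
  -- The clause for `j = i` forces the chosen family to contain `P` itself, whose open leaf is
  -- tracked.
  have h' : ∀ j, ∃ P' : Preproof RASystem, (j = i → P' = P) ∧ ∀ hj : j < R.prems.length,
      (j ≠ i → P'.Closed) ∧ RASound P' ∧ P'.endseq = R.prems[j] := by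
    intro j
    by_cases hji : j = i
    · subst hji
      exact ⟨P, fun _ => rfl, fun _ => ⟨fun h => absurd rfl h, hsd, he⟩⟩
    by_cases hj : j < R.prems.length
    · obtain ⟨P', hP'⟩ := h j hj hji
      exact ⟨P', fun h => absurd h hji, fun _ => ⟨fun _ => hP'.1, hP'.2⟩⟩
    · exact ⟨leaf _ R.concl, fun h => absurd h hji, fun h => absurd h hj⟩
  choose Q hQi hQ using h'
  obtain rfl := hQi i rfl
  refine ⟨graft (D := RASystem) R Q fun j hj => (hQ j hj).2.2, (i + 1) :: p,
    graft_assumption.2 ⟨i, hi, p, rfl, hp⟩, ?_, RASound.graft fun j hj => (hQ j hj).2.1, hC, rfl,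
    ?_, ?_⟩
  · intro t ht
    obtain ⟨j, hj, t, rfl, ht'⟩ := graft_assumption.1 ht
    by_cases hji : j = i
    · subst hji
      rw [hu t ht']
    · exact absurd ht' ((closed_iff _).1 ((hQ j hj).1 hji) t)
  · rintro (_ | ⟨j, s⟩) hs
    · exact hc
    · obtain ⟨rfl, hs'⟩ := List.cons_prefix_cons.1 hs
      exact hw s hs'
  · rintro (h | h)
    · obtain ⟨s, R', hs, hR', hk⟩ := hr h
      exact ⟨(i + 1) :: s, R', List.cons_prefix_cons.2 ⟨rfl, hs⟩,
        (graftRule_eq_some (R := R)).2 (Or.inr ⟨i, hi, s, rfl, hR'⟩), hk⟩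
    · exact ⟨[], R, List.nil_prefix, rfl, h⟩

theorem RABranch.unary {k : RuleKind} {e e' : RASeq} (hs : RAStep k e.1 [e'.1])
    (hc : ∃ v, e.1.ctrl = w ++ a :: v) (hb : RABranch w a r C e') :
    RABranch w a (r ∨ k = .reset a) C e :=
  RABranch.of_rule ⟨k, e, [e'], hs⟩ 0 (by simp) hb
    (fun j hj hne => absurd (by simpa using hj) hne) hc

theorem RABranch.binary {k : RuleKind} {e e₁ e₂ : RASeq} (hs : RAStep k e.1 [e₁.1, e₂.1])
    (hc : ∃ v, e.1.ctrl = w ++ a :: v) (h : RADerivable e₁) (hb : RABranch w a r C e₂) :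
    RABranch w a (r ∨ k = .reset a) C e :=
  RABranch.of_rule ⟨k, e, [e₁, e₂], hs⟩ 1 (by simp) hb
    (fun j hj hne => by
      obtain rfl : j = 0 := by simp at hj; omega
      exact h) hc

/-- The assumption has the label of the root, so it can become a bud. The path from companion to bud
is then the whole branch, on which `a` has the constant prefix `w` and is reset. The reset also
shows that the branch is not trivial, because no rule is applied at the assumption. -/
theorem RABranch.close (hr : r) (hb : RABranch w a r C C) : RADerivable C := by
  obtain ⟨P, p, hp, hu, hsd, hC, he, hw, hr'⟩ := hb
  obtain ⟨s, R, hs, hR, hk⟩ := hr' hr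
  have hne : p ≠ [] := by
    rintro rfl
    obtain rfl := List.prefix_nil.1 hs
    simp [hp.2.2] at hR
  refine ⟨P.closeLoop p hp hne (hC.trans he.symm), ?_, ?_, he⟩
  · rw [closed_iff]
    rintro t ⟨ht, htb, htr⟩
    have htp : t ≠ p := by
      rintro rfl
      simp [closeLoop] at htb
    exact htp (hu t ⟨ht, by simpa [closeLoop, htp] using htb, htr⟩)
  · intro t c htc
    by_cases htp : t = p
    · subst htp
      obtain rfl : [] = c := by simpa [closeLoop] using htc
      exact ⟨a, ⟨w, fun s _ hs => hw s hs⟩, s, R, List.nil_prefix, hs, hR, hk⟩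
    · exact hsd t c (by simpa [closeLoop, htp] using htc)

end ResetArithmetic

/-! ### Substitution with named bound variables -/

namespace ResetArithmetic

open Function

theorem sub₁_eq_update (t : Term) (x : ℕ) : sub₁ t x = update Term.var x t := by
  funext z
  simp [sub₁, update_apply]

namespace Term

theorem subst_congr {f g : ℕ → Term} : ∀ {t : Term}, (∀ z ∈ t.fv, f z = g z) →
    t.subst f = t.subst g
  | var x, h => h x (by simp [fv])
  | zero, _ => rfl
  | succ s, h => by rw [subst, subst, subst_congr (t := s) h]
  | add s t, h => by
    rw [subst, subst, subst_congr (t := s) fun z hz => h z (by simp [fv, hz]),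
      subst_congr (t := t) fun z hz => h z (by simp [fv, hz])]
  | mul s t, h => by
    rw [subst, subst, subst_congr (t := s) fun z hz => h z (by simp [fv, hz]),
      subst_congr (t := t) fun z hz => h z (by simp [fv, hz])]

theorem subst_var (t : Term) : t.subst var = t := by
  induction t <;> simp [subst, *]

theorem subst_subst (f g : ℕ → Term) (t : Term) :
    (t.subst f).subst g = t.subst fun z => (f z).subst g := by
  induction t <;> simp [subst, *]

theorem exists_of_mem_fv_subst {f : ℕ → Term} {v : ℕ} {t : Term} (h : v ∈ (t.subst f).fv) :
    ∃ z ∈ t.fv, v ∈ (f z).fv := by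
  induction t with
  | var x => exact ⟨x, by simp [fv], h⟩
  | zero => simp [subst, fv] at h
  | succ s ih => exact ih h
  | add s t ihs iht =>
    simp only [subst, fv, Finset.mem_union] at h ⊢
    grind
  | mul s t ihs iht =>
    simp only [subst, fv, Finset.mem_union] at h ⊢
    grind

end Term

namespace Form

open Term (var)

theorem subst_congr {f g : ℕ → Term} {φ : Form} (h : ∀ z ∈ φ.fv, f z = g z) :
    φ.subst f = φ.subst g := by
  induction φ generalizing f g with
  | eq s t | lt s t =>
    rw [subst, subst, Term.subst_congr (t := s) fun z hz => h z (by simp [fv, hz]),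
      Term.subst_congr (t := t) fun z hz => h z (by simp [fv, hz])]
  | bot => rfl
  | and φ ψ ih₁ ih₂ | or φ ψ ih₁ ih₂ | imp φ ψ ih₁ ih₂ =>
    rw [subst, subst, ih₁ fun z hz => h z (by simp [fv, hz]),
      ih₂ fun z hz => h z (by simp [fv, hz])]
  | all x φ ih | ex x φ ih =>
    rw [subst, subst, ih fun z hz => ?_]
    by_cases hzx : z = x
    · simp [hzx]
    · simp [hzx, h z (by simp [fv, hz, hzx])]

theorem subst_var (φ : Form) : φ.subst var = φ := by
  induction φ <;> simp [subst, Term.subst_var, *]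

theorem subst_eq_self {f : ℕ → Term} {φ : Form} (h : ∀ z ∈ φ.fv, f z = var z) :
    φ.subst f = φ :=
  (subst_congr h).trans φ.subst_var

theorem subst_sub₁_eq_self {t : Term} {x : ℕ} {φ : Form} (h : x ∉ φ.fv) :
    φ.subst (sub₁ t x) = φ :=
  subst_eq_self fun z hz => if_neg (by rintro rfl; exact h hz)

@[simp]
theorem bv_subst (f : ℕ → Term) (φ : Form) : (φ.subst f).bv = φ.bv := by
  induction φ generalizing f <;> simp [subst, bv, *]

theorem exists_of_mem_fv_subst {f : ℕ → Term} {v : ℕ} {φ : Form} (h : v ∈ (φ.subst f).fv) :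
    ∃ z ∈ φ.fv, v ∈ (f z).fv := by
  induction φ generalizing f with
  | eq s t | lt s t =>
    simp only [subst, fv, Finset.mem_union] at h ⊢
    obtain h | h := h
    · obtain ⟨z, hz, h⟩ := Term.exists_of_mem_fv_subst h
      exact ⟨z, Or.inl hz, h⟩
    · obtain ⟨z, hz, h⟩ := Term.exists_of_mem_fv_subst h
      exact ⟨z, Or.inr hz, h⟩
  | bot => simp [subst, fv] at h
  | and φ ψ ih₁ ih₂ | or φ ψ ih₁ ih₂ | imp φ ψ ih₁ ih₂ =>
    simp only [subst, fv, Finset.mem_union] at h ⊢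
    obtain h | h := h
    · obtain ⟨z, hz, h⟩ := ih₁ h
      exact ⟨z, Or.inl hz, h⟩
    · obtain ⟨z, hz, h⟩ := ih₂ h
      exact ⟨z, Or.inr hz, h⟩
  | all x φ ih | ex x φ ih =>
    simp only [subst, fv, Finset.mem_erase] at h ⊢
    obtain ⟨z, hz, hv⟩ := ih h.2
    by_cases hzx : z = x
    · subst hzx
      simp [Term.fv, h.1] at hv
    · exact ⟨z, ⟨hzx, hz⟩, by simpa [hzx] using hv⟩

theorem mem_fv_subst_sub₁_var {x y v : ℕ} {φ : Form} (h : v ∈ (φ.subst (sub₁ (var y) x)).fv) :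
    (v = y ∧ x ∈ φ.fv) ∨ (v ≠ x ∧ v ∈ φ.fv) := by
  obtain ⟨z, hz, hv⟩ := exists_of_mem_fv_subst h
  by_cases hzx : z = x
  · subst hzx
    exact Or.inl ⟨by simpa [sub₁, Term.fv] using hv, hz⟩
  · obtain rfl : v = z := by simpa [sub₁, hzx, Term.fv] using hv
    exact Or.inr ⟨hzx, hz⟩

/-- The substitution `f` captures no variable in `φ`. -/
def CaptureFree (f : ℕ → Term) : Form → Prop
  | eq _ _ => True
  | lt _ _ => True
  | bot => True
  | and φ ψ => φ.CaptureFree f ∧ ψ.CaptureFree f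
  | or φ ψ => φ.CaptureFree f ∧ ψ.CaptureFree f
  | imp φ ψ => φ.CaptureFree f ∧ ψ.CaptureFree f
  | all x φ => (∀ z ∈ φ.fv, z ≠ x → x ∉ (f z).fv) ∧ φ.CaptureFree (update f x (var x))
  | ex x φ => (∀ z ∈ φ.fv, z ≠ x → x ∉ (f z).fv) ∧ φ.CaptureFree (update f x (var x))

theorem captureFree_var (φ : Form) : φ.CaptureFree var := by
  induction φ with
  | all x φ ih | ex x φ ih =>
    refine ⟨fun z _ hzx => by simpa [Term.fv] using hzx.symm, ?_⟩
    rwa [update_eq_self]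
  | _ => simp_all [CaptureFree]

/-- The new value `w` is bound nowhere in `φ` and cannot be captured; below a binder of `v` the
change has no effect. -/
theorem CaptureFree.update_var {f : ℕ → Term} {φ : Form} (h : φ.CaptureFree f) (v : ℕ) {w : ℕ}
    (hw : w ∉ φ.bv) : φ.CaptureFree (update f v (var w)) := by
  induction φ generalizing f with
  | eq | lt | bot => trivial
  | and φ ψ ih₁ ih₂ | or φ ψ ih₁ ih₂ | imp φ ψ ih₁ ih₂ =>
    simp only [bv, Finset.mem_union, not_or] at hw
    exact ⟨ih₁ h.1 hw.1, ih₂ h.2 hw.2⟩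
  | all x φ ih | ex x φ ih =>
    simp only [bv, Finset.mem_insert, not_or] at hw
    refine ⟨fun z hz hzx => ?_, ?_⟩
    · by_cases hzv : z = v
      · subst hzv
        simpa [Term.fv] using fun h => hw.1 h.symm
      · simpa [hzv] using h.1 z hz hzx
    · by_cases hvx : v = x
      · subst hvx
        rw [update_idem]
        exact h.2
      · rw [update_comm hvx]
        exact ih h.2 hw.2

theorem captureFree_sub₁_var {φ : Form} {x y : ℕ} (h : y ∉ φ.bv) :
    φ.CaptureFree (sub₁ (var y) x) := by
  rw [sub₁_eq_update]
  exact φ.captureFree_var.update_var x h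

/-- Below a binder of `x` the map `g` is turned off at `x`. This does no harm as long as `f` brings
no new `x` there. -/
theorem subst_subst {f : ℕ → Term} (g : ℕ → Term) {φ : Form} (h : φ.CaptureFree f) :
    (φ.subst f).subst g = φ.subst fun z => (f z).subst g := by
  induction φ generalizing f g with
  | eq | lt => simp [subst, Term.subst_subst]
  | bot => rfl
  | and φ ψ ih₁ ih₂ | or φ ψ ih₁ ih₂ | imp φ ψ ih₁ ih₂ => simp [subst, ih₁ g h.1, ih₂ g h.2]
  | all x φ ih | ex x φ ih =>
    simp only [subst, ih _ h.2]
    congr 1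
    refine subst_congr fun z hz => ?_
    by_cases hzx : z = x
    · simp [hzx, Term.subst]
    · simp only [update_of_ne hzx]
      refine Term.subst_congr fun u hu => update_of_ne ?_ _ _
      rintro rfl
      exact h.1 z hz hzx hu

/-- The formula on the left is what the quantifier rules produce when `∀v. φ` or `∃v. φ`, after the
substitution `f`, is instantiated with `t`. -/
theorem subst_update_sub₁ {f : ℕ → Term} {φ : Form} {v : ℕ} (t : Term)
    (h : ∀ z ∈ φ.fv, z ≠ v → v ∉ (f z).fv) (hc : φ.CaptureFree (update f v (var v))) :
    (φ.subst (update f v (var v))).subst (sub₁ t v) = φ.subst (update f v t) := by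
  rw [subst_subst _ hc]
  refine subst_congr fun z hz => ?_
  by_cases hzv : z = v
  · simp [hzv, Term.subst, sub₁]
  · simp only [update_of_ne hzv]
    refine (Term.subst_congr fun u hu => ?_).trans (Term.subst_var _)
    refine if_neg ?_
    rintro rfl
    exact h z hz hzv hu

theorem subst_sub₁_sub₁ {φ : Form} {x w : ℕ} (t : Term) (hw : w ∉ φ.bv) (hw' : w ∉ φ.fv) :
    (φ.subst (sub₁ (var w) x)).subst (sub₁ t w) = φ.subst (sub₁ t x) := by
  rw [subst_subst _ (captureFree_sub₁_var hw)]
  refine subst_congr fun z hz => ?_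
  have hzw : z ≠ w := fun h => hw' (h ▸ hz)
  by_cases hzx : z = x <;> simp [sub₁, hzx, Term.subst]
  simp_all

end Form

end ResetArithmetic

/-! ### The rules of cyclic arithmetic inside reset arithmetic -/

namespace ResetArithmetic

open Term (var succ)
open Form (eq lt bot and or imp all ex)
open Function

/-- Pruning the control and substituting in assignments both compute to the empty list and the empty
set here, so each case holds by definition. -/
theorem CAStep.raStep {S : CASeq} {L : List CASeq} (h : CAStep S L) :
    RAStep .ordinary (RASeq.ofCA S).1 ((L.map RASeq.ofCA).map Subtype.val) := by
  cases h with
  | ax Γ Δ φ => exact .ax [] ∅ Γ Δ φ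
  | botL Γ Δ => exact .botL [] ∅ Γ Δ
  | impL Γ Δ φ ψ => exact .impL [] ∅ Γ Δ φ ψ
  | impR Γ Δ φ ψ => exact .impR [] ∅ Γ Δ φ ψ
  | andL Γ Δ φ ψ => exact .andL [] ∅ Γ Δ φ ψ
  | andR Γ Δ φ ψ => exact .andR [] ∅ Γ Δ φ ψ
  | orL Γ Δ φ ψ => exact .orL [] ∅ Γ Δ φ ψ
  | orR Γ Δ φ ψ => exact .orR [] ∅ Γ Δ φ ψ
  | allL Γ Δ x φ t h => exact .allL [] ∅ Γ Δ x φ t h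
  | allR Γ Δ x φ h => exact .allR [] ∅ Γ Δ x φ h
  | exL Γ Δ x φ h => exact .exL [] ∅ Γ Δ x φ h
  | exR Γ Δ x φ t h => exact .exR [] ∅ Γ Δ x φ t h
  | eqL Γ Δ s t x y hxy hx hy hd => exact .eqL [] ∅ Γ Δ s t x y hxy hx hy hd
  | eqR Γ Δ t => exact .eqR [] ∅ Γ Δ t
  | wk Γ Γ' Δ Δ' => exact .wk [] ∅ ∅ Γ Γ' Δ Δ'
  | cut Γ Δ φ => exact .cut [] ∅ Γ Δ φ
  | sub Γ Δ s x hd => exact .sub [] ∅ Γ Δ s x hd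
  | arith S h => exact .arith [] ∅ S h
  | succCase Γ Δ t x h => exact .succCase [] ∅ Γ Δ t x h

namespace RAProves

theorem step {S : CASeq} {L : List CASeq} (h : CAStep S L) (hL : ∀ S' ∈ L, RAProves S') :
    RAProves S :=
  RADerivable.step (L.map RASeq.ofCA) h.raStep fun e he => by
    obtain ⟨S', hS', rfl⟩ := List.mem_map.1 he
    exact hL S' hS'

theorem step₁ {S S₁ : CASeq} (h : CAStep S [S₁]) (h₁ : RAProves S₁) : RAProves S :=
  step h (by simpa using h₁)

theorem step₂ {S S₁ S₂ : CASeq} (h : CAStep S [S₁, S₂]) (h₁ : RAProves S₁) (h₂ : RAProves S₂) :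
    RAProves S :=
  step h (by simpa using ⟨h₁, h₂⟩)

variable {Γ Δ Γ' Δ' : Finset Form} {φ ψ : Form}

theorem mono (h : RAProves (Γ ⟹ Δ)) (hΓ : Γ ⊆ Γ') (hΔ : Δ ⊆ Δ') : RAProves (Γ' ⟹ Δ') := by
  have := step₁ (.wk Γ Γ' Δ Δ') h
  rwa [Finset.union_eq_right.2 hΓ, Finset.union_eq_right.2 hΔ] at this

theorem ax (φ : Form) (h : φ ∈ Γ) (h' : φ ∈ Δ) : RAProves (Γ ⟹ Δ) := by
  have := step (.ax Γ Δ φ) (by simp)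
  rwa [Finset.insert_eq_of_mem h, Finset.insert_eq_of_mem h'] at this

theorem cut (φ : Form) (h : RAProves (Γ ⟹ insert φ Δ)) (h' : RAProves (insert φ Γ ⟹ Δ)) :
    RAProves (Γ ⟹ Δ) :=
  step₂ (.cut Γ Δ φ) h' h

theorem impL (hm : imp φ ψ ∈ Γ) (h : RAProves (Γ ⟹ insert φ Δ)) (h' : RAProves (insert ψ Γ ⟹ Δ)) :
    RAProves (Γ ⟹ Δ) := by
  have := step₂ (.impL Γ Δ φ ψ) h' h
  rwa [Finset.insert_eq_of_mem hm] at this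

theorem impR (h : RAProves (insert φ Γ ⟹ insert ψ Δ)) : RAProves (Γ ⟹ insert (imp φ ψ) Δ) :=
  step₁ (.impR Γ Δ φ ψ) h

theorem andL (hm : and φ ψ ∈ Γ) (h : RAProves (insert φ (insert ψ Γ) ⟹ Δ)) :
    RAProves (Γ ⟹ Δ) := by
  have := step₁ (.andL Γ Δ φ ψ) h
  rwa [Finset.insert_eq_of_mem hm] at this

theorem andR (h : RAProves (Γ ⟹ insert φ Δ)) (h' : RAProves (Γ ⟹ insert ψ Δ)) :
    RAProves (Γ ⟹ insert (and φ ψ) Δ) :=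
  step₂ (.andR Γ Δ φ ψ) h h'

theorem orL (hm : or φ ψ ∈ Γ) (h : RAProves (insert φ Γ ⟹ Δ)) (h' : RAProves (insert ψ Γ ⟹ Δ)) :
    RAProves (Γ ⟹ Δ) := by
  have := step₂ (.orL Γ Δ φ ψ) h h'
  rwa [Finset.insert_eq_of_mem hm] at this

theorem orR (h : RAProves (Γ ⟹ insert φ (insert ψ Δ))) : RAProves (Γ ⟹ insert (or φ ψ) Δ) :=
  step₁ (.orR Γ Δ φ ψ) h

theorem allL {x : ℕ} (t : Term) (hm : all x φ ∈ Γ) (ht : φ.Subst1Ok t)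
    (h : RAProves (insert (φ.subst (sub₁ t x)) Γ ⟹ Δ)) : RAProves (Γ ⟹ Δ) := by
  have := step₁ (.allL Γ Δ x φ t ht) h
  rwa [Finset.insert_eq_of_mem hm] at this

theorem allR {x : ℕ} (hx : x ∉ fvs Γ Δ) (h : RAProves (Γ ⟹ insert φ Δ)) :
    RAProves (Γ ⟹ insert (all x φ) Δ) :=
  step₁ (.allR Γ Δ x φ hx) h

theorem exL {x : ℕ} (hx : x ∉ fvs Γ Δ) (h : RAProves (insert φ Γ ⟹ Δ)) :
    RAProves (insert (ex x φ) Γ ⟹ Δ) :=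
  step₁ (.exL Γ Δ x φ hx) h

theorem exR {x : ℕ} (t : Term) (ht : φ.Subst1Ok t)
    (h : RAProves (Γ ⟹ insert (φ.subst (sub₁ t x)) Δ)) : RAProves (Γ ⟹ insert (ex x φ) Δ) :=
  step₁ (.exR Γ Δ x φ t ht) h

theorem eqR (t : Term) : RAProves (Γ ⟹ insert (eq t t) Δ) :=
  step (.eqR Γ Δ t) (by simp)

theorem arith {S : CASeq} (h : ArithAx S) : RAProves S :=
  step (.arith S h) (by simp)

end RAProves

theorem exists_fresh (s : Finset ℕ) : ∃ x, x ∉ s := Infinite.exists_notMem_finset s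

theorem mem_fvs {x : ℕ} {Γ Δ : Finset Form} :
    x ∈ fvs Γ Δ ↔ (∃ φ ∈ Γ, x ∈ φ.fv) ∨ ∃ φ ∈ Δ, x ∈ φ.fv := by
  simp [fvs]

/-! ### Replacement of equals -/

namespace RAProves

variable {Γ Δ : Finset Form}

/-- Add `w = v` to the antecedent for a fresh variable `w`. -/
theorem of_fresh_eq {v w : ℕ} (hw : w ∉ fvs Γ Δ)
    (h : RAProves (insert (eq (var w) (var v)) Γ ⟹ Δ)) : RAProves (Γ ⟹ Δ) := by
  refine cut (ex w (eq (var w) (var v))) (exR (var v) (by simp [Form.Subst1Ok, Form.bv]) ?_)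
    (exL hw h)
  have : (eq (var w) (var v)).subst (sub₁ (var v) w) = eq (var v) (var v) := by
    simp [Form.subst, Term.subst, sub₁]
  rw [this]
  exact eqR _

/-- The rule for equations in the antecedent, for a quantifier-free formula. -/
theorem eq_subst {φ : Form} (hb : φ.bv = ∅) (p q x : ℕ) (hxp : x ≠ p) (hxq : x ≠ q) :
    RAProves ({eq (var p) (var q), φ.subst (sub₁ (var p) x)} ⟹ {φ.subst (sub₁ (var q) x)}) := by
  -- The rule `=L` exchanges the two sides at `x` and `y`; a fresh `y` makes it a replacement at `x`
  -- alone. Its premise is then an instance of the axiom rule.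
  obtain ⟨y, hy⟩ := exists_fresh ({p, q, x} ∪ φ.fv)
  simp only [Finset.mem_union, Finset.mem_insert, Finset.mem_singleton, not_or] at hy
  have e₁ : φ.subst (sub₂ (var p) x (var q) y) = φ.subst (sub₁ (var p) x) :=
    Form.subst_congr fun z hz => by
      have : z ≠ y := by rintro rfl; exact hy.2 hz
      simp [sub₁, sub₂, this]
  have e₂ : φ.subst (sub₂ (var q) x (var p) y) = φ.subst (sub₁ (var q) x) :=
    Form.subst_congr fun z hz => by
      have : z ≠ y := by rintro rfl; exact hy.2 hz
      simp [sub₁, sub₂, this]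
  have e₃ : ∀ s t, (φ.subst (sub₁ (var q) x)).subst (sub₂ s x t y) = φ.subst (sub₁ (var q) x) :=
    fun s t => Form.subst_eq_self fun z hz => by
      obtain ⟨rfl, -⟩ | ⟨h, hz⟩ := Form.mem_fv_subst_sub₁_var hz
      · simp [sub₂, hxq.symm, Ne.symm hy.1.2.1]
      · have : z ≠ y := by rintro rfl; exact hy.2 hz
        simp [sub₂, h, this]
  have := CAStep.eqL {φ} {φ.subst (sub₁ (var q) x)} (var p) (var q) x y (Ne.symm hy.1.2.2)
    (by simp [Term.fv, hxp, hxq]) (by simp [Term.fv, hy.1.1, hy.1.2.1])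
    (by simp [Form.Subst2Ok, hb])
  simp only [substs, Finset.image_singleton, e₁, e₂, e₃] at this
  exact step₁ this (ax (φ.subst (sub₁ (var q) x)) (by simp) (by simp))

theorem eq_symm (p q : ℕ) :
    RAProves ({eq (var p) (var q)} ⟹ {eq (var q) (var p)}) := by
  obtain ⟨x, hx⟩ := exists_fresh {p, q}
  simp only [Finset.mem_insert, Finset.mem_singleton, not_or] at hx
  -- Replacing `p` by `q` on the left of `p = p`.
  have := eq_subst (φ := eq (var x) (var p)) (by simp [Form.bv]) p q x hx.1 hx.2
  simp only [Form.subst, Term.subst, sub₁, if_true, Ne.symm hx.1, if_false] at this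
  exact cut (eq (var p) (var p)) (eqR _) (this.mono (by grind) (by simp))

/-- A fresh `y` in the place of `x` separates it from the values of `f`, which may contain any
variable; then `eq_subst` applies at `y`. -/
theorem congr_atom {φ : Form} (hb : φ.bv = ∅) (f : ℕ → Term) (x p q : ℕ) :
    RAProves ({eq (var p) (var q), φ.subst (update f x (var p))} ⟹
      {φ.subst (update f x (var q))}) := by
  obtain ⟨y, hy⟩ := exists_fresh ({p, q} ∪ φ.fv.biUnion fun z => (f z).fv)
  simp only [Finset.mem_union, Finset.mem_insert, Finset.mem_singleton, not_or,
    Finset.mem_biUnion, not_exists, not_and] at hy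
  have hcf : ∀ (φ : Form) (g : ℕ → Term), φ.bv = ∅ → φ.CaptureFree g := by
    intro φ g h
    induction φ <;> simp_all [Form.CaptureFree, Form.bv]
  have key : ∀ r, (φ.subst (update f x (var y))).subst (sub₁ (var r) y) =
      φ.subst (update f x (var r)) := by
    intro r
    rw [Form.subst_subst _ (hcf _ _ hb)]
    refine Form.subst_congr fun z hz => ?_
    by_cases hzx : z = x
    · simp [hzx, Term.subst, sub₁]
    · simp only [update_of_ne hzx]
      refine (Term.subst_congr fun u hu => ?_).trans (Term.subst_var _)
      refine if_neg ?_
      rintro rfl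
      exact hy.2 z hz hu
  have := eq_subst (φ := φ.subst (update f x (var y))) (by simpa using hb) p q y hy.1.1 hy.1.2
  rwa [key, key] at this

/-- Replacement of variables by equal ones, in formulas that may bind them. -/
theorem congr (φ : Form) : ∀ (f : ℕ → Term) (x p q : ℕ), φ.CaptureFree (update f x (var p)) →
    φ.CaptureFree (update f x (var q)) →
    RAProves ({eq (var p) (var q), φ.subst (update f x (var p))} ⟹
      {φ.subst (update f x (var q))}) := by
  induction φ with
  | eq s t | lt s t => exact fun f x p q _ _ => congr_atom rfl f x p q
  | bot => exact fun f x p q _ _ => ax bot (by simp [Form.subst]) (by simp [Form.subst])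
  | and φ ψ ih₁ ih₂ =>
    intro f x p q h h'
    refine andL (φ := φ.subst (update f x (var p))) (ψ := ψ.subst (update f x (var p)))
      (by simp [Form.subst]) (andR (Δ := ∅) ?_ ?_)
    · exact (ih₁ f x p q h.1 h'.1).mono (by grind) (by grind)
    · exact (ih₂ f x p q h.2 h'.2).mono (by grind) (by grind)
  | or φ ψ ih₁ ih₂ =>
    intro f x p q h h'
    refine orL (φ := φ.subst (update f x (var p))) (ψ := ψ.subst (update f x (var p)))
      (by simp [Form.subst]) (orR (Δ := ∅) ?_) (orR (Δ := ∅) ?_)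
    · exact (ih₁ f x p q h.1 h'.1).mono (by grind) (by grind)
    · exact (ih₂ f x p q h.2 h'.2).mono (by grind) (by grind)
  | imp φ ψ ih₁ ih₂ =>
    intro f x p q h h'
    refine impR (Δ := ∅) (impL (φ := φ.subst (update f x (var p)))
      (ψ := ψ.subst (update f x (var p))) (by simp [Form.subst]) ?_ ?_)
    -- The premise of an implication is contravariant, so the equation is reversed.
    · refine cut (eq (var q) (var p)) ((eq_symm p q).mono (by grind) (by grind)) ?_
      exact (ih₁ f x q p h'.1 h.1).mono (by grind) (by grind)
    · exact (ih₂ f x p q h.2 h'.2).mono (by grind) (by grind)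
  | all v ψ ih =>
    intro f x p q h h'
    by_cases hvx : v = x
    · subst hvx
      refine ax (all v (ψ.subst (update f v (var v)))) ?_ ?_ <;> simp [Form.subst]
    -- If `x` is not free, both sides coincide. Otherwise capture-freeness gives `v ≠ p` and `v ≠
    -- q`, as the eigenvariable condition for `v` requires.
    by_cases hx : x ∉ ψ.fv
    · refine ax _ ?_ (Finset.mem_singleton_self _)
      have : (all v ψ).subst (update f x (var p)) = (all v ψ).subst (update f x (var q)) :=
        Form.subst_congr fun z hz => by
          have : z ≠ x := by rintro rfl; simp [Form.fv, hx] at hz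
          simp [this]
      simp [this]
    rw [not_not] at hx
    have hvp : v ≠ p := by simpa [Term.fv] using h.1 x hx (Ne.symm hvx)
    have hvq : v ≠ q := by simpa [Term.fv] using h'.1 x hx (Ne.symm hvx)
    -- Instantiating with `v` itself is forbidden when `v` is bound again in `ψ`. The detour is to
    -- instantiate with a fresh `w`, replace `p` by `q`, and then replace `w` by `v` using `w = v`.
    -- Both replacements are instances of the induction hypothesis, which is why `f` and the
    -- variables are kept general.
    obtain ⟨w, hw⟩ := exists_fresh (({v} ∪ ψ.bv) ∪ fvs {eq (var p) (var q),
      (all v ψ).subst (update f x (var p))} {ψ.subst (update (update f x (var q)) v (var v))})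
    simp only [Finset.mem_union, Finset.mem_singleton, not_or] at hw
    refine allR (Δ := ∅) ?_ (of_fresh_eq (v := v) hw.2 ?_)
    · simp [fvs, Form.fv, Term.fv, hvp, hvq, Form.subst]
    refine allL (x := v) (φ := ψ.subst (update (update f x (var p)) v (var v))) (var w)
      (by simp [Form.subst]) (by simp [Form.Subst1Ok, Term.fv, hw.1.2]) ?_
    rw [Form.subst_update_sub₁ _ h.1 h.2]
    refine cut (ψ.subst (update (update f x (var q)) v (var w))) ?_ ?_
    · have := ih (update f v (var w)) x p q
      rw [update_comm hvx, update_comm hvx] at this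
      refine (this ?_ ?_).mono (by grind) (by grind)
      · simpa using h.2.update_var v hw.1.2
      · simpa using h'.2.update_var v hw.1.2
    · refine (ih (update f x (var q)) v w v ?_ h'.2).mono (by grind) (by grind)
      simpa using h'.2.update_var v hw.1.2
  | ex v ψ ih =>
    intro f x p q h h'
    by_cases hvx : v = x
    · subst hvx
      refine ax (ex v (ψ.subst (update f v (var v)))) ?_ ?_ <;> simp [Form.subst]
    by_cases hx : x ∉ ψ.fv
    · refine ax _ ?_ (Finset.mem_singleton_self _)
      have : (ex v ψ).subst (update f x (var p)) = (ex v ψ).subst (update f x (var q)) :=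
        Form.subst_congr fun z hz => by
          have : z ≠ x := by rintro rfl; simp [Form.fv, hx] at hz
          simp [this]
      simp [this]
    rw [not_not] at hx
    have hvp : v ≠ p := by simpa [Term.fv] using h.1 x hx (Ne.symm hvx)
    have hvq : v ≠ q := by simpa [Term.fv] using h'.1 x hx (Ne.symm hvx)
    obtain ⟨w, hw⟩ := exists_fresh (({v} ∪ ψ.bv) ∪ fvs {ψ.subst (update (update f x (var p)) v
      (var v)), eq (var p) (var q)} {(ex v ψ).subst (update f x (var q))})
    simp only [Finset.mem_union, Finset.mem_singleton, not_or] at hw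
    rw [Finset.pair_comm]
    refine exL ?_ (of_fresh_eq (v := v) hw.2 ?_)
    · simp [fvs, Form.fv, Term.fv, hvp, hvq, Form.subst]
    refine exR (Δ := ∅) (x := v) (φ := ψ.subst (update (update f x (var q)) v (var v))) (var w)
      (by simp [Form.Subst1Ok, Term.fv, hw.1.2]) ?_
    rw [Form.subst_update_sub₁ _ h'.1 h'.2]
    -- Dually, `v` is first replaced by the fresh witness `w`, then `p` by `q`.
    refine cut (ψ.subst (update (update f x (var p)) v (var w))) ?_ ?_
    · refine cut (eq (var v) (var w)) ((eq_symm w v).mono (by grind) (by grind)) ?_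
      refine (ih (update f x (var p)) v v w h.2 ?_).mono (by grind) (by grind)
      simpa using h.2.update_var v hw.1.2
    · have := ih (update f v (var w)) x p q
      rw [update_comm hvx, update_comm hvx] at this
      refine (this ?_ ?_).mono (by grind) (by grind)
      · simpa using h.2.update_var v hw.1.2
      · simpa using h'.2.update_var v hw.1.2

end RAProves

/-! ### Induction by a cyclic proof -/

theorem Form.lt_mem_terms {S : CASeq} {s t : Term} (h : lt s t ∈ S.antecedent) :
    s ∈ S.terms ∧ t ∈ S.terms := by
  have self_mem : ∀ t : Term, t ∈ t.subterms := by
    rintro (_ | _ | _ | _ | _) <;> simp [Term.subterms]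
  constructor <;> refine Finset.mem_union_left _ (Finset.mem_biUnion.2 ⟨_, h, ?_⟩) <;>
    simp [Form.terms, self_mem]

theorem isSequent_singleton {Θ u : List ℕ} {t : Term} {S : CASeq} (hΘ : Θ.Nodup)
    (ht : t ∈ S.terms) (hu : u.Sublist Θ) : RAExpr.IsSequent ⟨Θ, {(t, u)}, S⟩ :=
  ⟨hΘ, by simpa using ⟨ht, hu⟩⟩

theorem substs_sub₁_eq_self {Γ : Finset Form} {t : Term} {x : ℕ} (h : ∀ φ ∈ Γ, x ∉ φ.fv) :
    substs (sub₁ t x) Γ = Γ := by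
  have : substs (sub₁ t x) Γ = Γ.image id :=
    Finset.image_congr fun φ hφ => Form.subst_sub₁_eq_self (h φ hφ)
  simpa using this

@[simp]
theorem substs_insert (f : ℕ → Term) (φ : Form) (Γ : Finset Form) :
    substs f (insert φ Γ) = insert (φ.subst f) (substs f Γ) :=
  Finset.image_insert _ _ _

@[simp]
theorem substs_singleton (f : ℕ → Term) (φ : Form) : substs f {φ} = {φ.subst f} :=
  Finset.image_singleton _ _

/-- Induction for `A` by a cyclic proof. -/
theorem RAProves.induction {Γ : Finset Form} {A : Form} {z w v : ℕ} (hwz : w ≠ z) (hvz : v ≠ z)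
    (hvw : v ≠ w)
    (hz : ∀ φ ∈ Γ, z ∉ φ.fv ∧ z ∉ φ.bv) (hw : ∀ φ ∈ Γ, w ∉ φ.fv ∧ w ∉ φ.bv)
    (hv : ∀ φ ∈ Γ, v ∉ φ.fv) (hAz : z ∉ A.bv) (hAw : w ∉ A.fv ∧ w ∉ A.bv) (hAv : v ∉ A.fv)
    (h : RAProves (insert (all w (imp (lt (var w) (var z)) (A.subst (sub₁ (var w) z)))) Γ ⟹
      {A})) :
    RAProves (Γ ⟹ {A}) := by
  set B := A.subst (sub₁ (var w) z)
  set K := all w (imp (lt (var w) (var z)) B)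
  have hBfv : ∀ u, u ≠ w → u ∉ A.fv → u ∉ B.fv := by
    intro u huw hu hB
    obtain ⟨rfl, -⟩ | ⟨-, h⟩ := Form.mem_fv_subst_sub₁_var hB
    exacts [huw rfl, hu h]
  have hBbv : B.bv = A.bv := Form.bv_subst _ _
  -- the companion, which is also the bud
  let C : RASeq := ⟨⟨[0], {(var z, [0])}, insert (lt (var z) (var v)) Γ ⟹ {A}⟩,
    isSequent_singleton (by simp) (Form.lt_mem_terms (Finset.mem_insert_self _ _)).1 (by simp)⟩
  -- The branch is built from the bud downwards. The formula `z < v` keeps `z` among the terms of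
  -- the sequent even if `A` does not mention it, so that a letter can be assigned to it.
  have b : RABranch [] 0 False C C := RABranch.refl ⟨[], rfl⟩
  let e₁ : RASeq := ⟨⟨[0], {(var w, [0])}, insert (lt (var w) (var v)) Γ ⟹ {B}⟩,
    isSequent_singleton (by simp) (Form.lt_mem_terms (Finset.mem_insert_self _ _)).1 (by simp)⟩
  have s₁ : RAStep .ordinary e₁.1 [C.1] := by
    have := RAStep.sub [0] {(var z, [0])} (insert (lt (var z) (var v)) Γ) {A} (var w) z (by
      simp only [Finset.mem_union, Finset.mem_insert, Finset.mem_singleton]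
      rintro φ ((rfl | hφ) | rfl)
      · simp [Form.Subst1Ok, Form.bv]
      · simp [Form.Subst1Ok, Term.fv, (hw φ hφ).2]
      · simp [Form.Subst1Ok, Term.fv, hAw.2])
    simpa [substAsg, Form.subst, Term.subst, sub₁, hvz, C, e₁, B,
      substs_sub₁_eq_self fun φ hφ => (hz φ hφ).1] using this
  have b := b.unary s₁ ⟨[], rfl⟩
  let e₂ : RASeq := ⟨⟨[0], {(var w, [0])}, insert (lt (var w) (var z)) Γ ⟹ {B}⟩,
    isSequent_singleton (by simp) (Form.lt_mem_terms (Finset.mem_insert_self _ _)).1 (by simp)⟩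
  have s₂ : RAStep .ordinary e₂.1 [e₁.1] := by
    have := RAStep.sub [0] {(var w, [0])} (insert (lt (var w) (var v)) Γ) {B} (var z) v (by
      simp only [Finset.mem_union, Finset.mem_insert, Finset.mem_singleton]
      rintro φ ((rfl | hφ) | rfl)
      · simp [Form.Subst1Ok, Form.bv]
      · simp [Form.Subst1Ok, Term.fv, (hz φ hφ).2]
      · simp [Form.Subst1Ok, Term.fv, hBbv, hAz])
    simpa [substAsg, Form.subst, Term.subst, sub₁, Ne.symm hvw, e₁, e₂,
      substs_sub₁_eq_self hv, Form.subst_sub₁_eq_self (hBfv v hvw hAv)] using this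
  have b := b.unary s₂ ⟨[], rfl⟩
  let S : CASeq := insert (lt (var w) (var z)) (insert (lt (var z) (var v)) Γ) ⟹ {B, A}
  let e₃ : RASeq := ⟨⟨[0], {(var w, [0])}, S⟩,
    isSequent_singleton (by simp) (Form.lt_mem_terms (Finset.mem_insert_self _ _)).1 (by simp)⟩
  have s₃ : RAStep .ordinary e₃.1 [e₂.1] := by
    have := RAStep.wk [0] {(var w, [0])} ∅ (insert (lt (var w) (var z)) Γ)
      (insert (lt (var z) (var v)) Γ) {B} {A}
    have hΓ : insert (lt (var w) (var z)) Γ ∪ insert (lt (var z) (var v)) Γ =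
      insert (lt (var w) (var z)) (insert (lt (var z) (var v)) Γ) := by grind
    have hΔ : ({B} ∪ {A} : Finset Form) = {B, A} := rfl
    have hΘ : pruneCtrl [0] {(var w, [0])} = [0] := by simp [pruneCtrl]
    rwa [hΓ, hΔ, hΘ, Finset.union_empty] at this
  have b := b.unary s₃ ⟨[], rfl⟩
  let e₄ : RASeq := ⟨⟨[0, 1], {(var w, [0, 1])}, S⟩,
    isSequent_singleton (by simp) (Form.lt_mem_terms (Finset.mem_insert_self _ _)).1 (by simp)⟩
  have s₄ : RAStep (.reset 0) e₄.1 [e₃.1] := by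
    -- The word `01` is split as `ε`, the letter 0, and the non-empty rest `1`; the premise loses
    -- the letter 1.
    have := RAStep.reset [0, 1] ∅ S [] 0 {(var w, [1])} (by simp) (by simp) (by simp)
    simpa [pruneCtrl] using this
  have b := b.unary s₄ ⟨[1], rfl⟩
  let e₅ : RASeq := ⟨⟨[0], {(var z, [0])}, S⟩,
    isSequent_singleton (by simp) (Form.lt_mem_terms (Finset.mem_insert_self _ _)).2 (by simp)⟩
  have s₅ : RAStep .ordinary e₅.1 [e₄.1] := by
    -- The context already contains `w < z`, so the inequality survives into the premise, where the
    -- substitutions need it.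
    have := RAStep.ltL [0] ∅ S.antecedent S.succedent (var w) (var z) [0] 1 (by simp)
    simpa [S] using this
  have b := b.unary s₅ ⟨[], rfl⟩
  let e₆ : RASeq := ⟨⟨[0], {(var z, [0])}, insert (lt (var z) (var v)) Γ ⟹
    {imp (lt (var w) (var z)) B, A}⟩,
    isSequent_singleton (by simp) (Form.lt_mem_terms (Finset.mem_insert_self _ _)).1 (by simp)⟩
  have b := b.unary (e := e₆) (.impR _ _ _ _ _ _) ⟨[], rfl⟩
  let e₇ : RASeq := ⟨⟨[0], {(var z, [0])}, insert (lt (var z) (var v)) Γ ⟹ {K, A}⟩,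
    isSequent_singleton (by simp) (Form.lt_mem_terms (Finset.mem_insert_self _ _)).1 (by simp)⟩
  have b := b.unary (e := e₇) (.allR _ _ _ _ _ _ (by
    simp only [mem_fvs, Finset.mem_insert, Finset.mem_singleton]
    rintro (⟨φ, rfl | hφ, h'⟩ | ⟨φ, rfl, h'⟩)
    · simp [Form.fv, Term.fv, hwz, hvw.symm] at h'
    · exact (hw φ hφ).1 h'
    · exact hAw.1 h')) ⟨[], rfl⟩
  let e₈ : RASeq := ⟨⟨[0], {(var z, [0])}, insert K (insert (lt (var z) (var v)) Γ) ⟹ {A}⟩,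
    isSequent_singleton (by simp) (Form.lt_mem_terms (s := var z) (t := var v) (by simp)).1
      (by simp)⟩
  have d : RADerivable e₈ := by
    refine RADerivable.step (k := .ordinary) [.ofCA (insert K Γ ⟹ {A})] ?_
      (by simp only [List.mem_singleton, forall_eq]; exact h)
    -- Dropping the only assignment empties the control, which leaves exactly the given hypothesis.
    have := RAStep.wk [0] ∅ {(var z, [0])} (insert K Γ) (insert (lt (var z) (var v)) Γ) {A} {A}
    have hΓ : insert K Γ ∪ insert (lt (var z) (var v)) Γ =
      insert K (insert (lt (var z) (var v)) Γ) := by grind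
    rwa [hΓ, Finset.union_self, Finset.empty_union] at this
  have b := b.binary (e := C) (.cut _ _ _ _ _) ⟨[], rfl⟩ d
  have d : RADerivable C := b.close (by simp)
  let e₉ : RASeq := ⟨⟨[], {(var v, [])}, insert (lt (var z) (var v)) Γ ⟹ {A}⟩,
    isSequent_singleton (by simp) (Form.lt_mem_terms (Finset.mem_insert_self _ _)).2 (by simp)⟩
  have d : RADerivable e₉ := by
    refine RADerivable.step (k := .ordinary) [C] ?_ (by simpa using d)
    -- The letter 0 of the cycle originates here, from `v ↦ ε`.
    have := RAStep.ltL [] ∅ (insert (lt (var z) (var v)) Γ) {A} (var z) (var v) [] 0 (by simp)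
    simpa using this
  have d : RAProves (insert (lt (var z) (var v)) Γ ⟹ {A}) :=
    RADerivable.step [e₉] (.focus _ _ _ _ (e₉.2.2 _ (Finset.mem_singleton_self _)).1)
      (by simpa using d)
  have d : RAProves (insert (lt (var z) (succ (var z))) Γ ⟹ {A}) := by
    have := CAStep.sub (insert (lt (var z) (var v)) Γ) {A} (succ (var z)) v (by
      simp only [Finset.mem_union, Finset.mem_insert, Finset.mem_singleton]
      rintro φ ((rfl | hφ) | rfl)
      · simp [Form.Subst1Ok, Form.bv]
      · simp [Form.Subst1Ok, Term.fv, (hz φ hφ).2]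
      · simp [Form.Subst1Ok, Term.fv, hAz])
    refine RAProves.step₁ ?_ d
    simpa [Form.subst, Term.subst, sub₁, hvz.symm, substs_sub₁_eq_self hv,
      Form.subst_sub₁_eq_self hAv] using this
  exact RAProves.cut _ ((RAProves.arith (.lt_succ (var z))).mono (by simp) (by simp)) d

theorem RAProves.inductionFormula {x y : ℕ} {φ : Form} (hyx : y ≠ x) (hyf : y ∉ φ.fv)
    (hyb : y ∉ φ.bv) : RAProves (∅ ⟹ {ResetArithmetic.inductionFormula x y φ}) := by
  set B := imp (all y (imp (lt (var y) (var x)) (φ.subst (sub₁ (var y) x)))) φ with hB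
  have hHfv : ∀ u, u ∉ φ.fv → u ∉ (all x B).fv := by
    intro u hu h
    simp only [hB, Form.fv, Term.fv, Finset.mem_erase, Finset.mem_union, Finset.mem_singleton]
      at h
    obtain ⟨h₁, ⟨h₂, (h | h) | h⟩ | h⟩ := h
    · exact h₂ h
    · exact h₁ h
    · obtain ⟨h, -⟩ | ⟨-, h⟩ := Form.mem_fv_subst_sub₁_var h
      exacts [h₂ h, hu h]
    · exact hu h
  have hHx : x ∉ (all x B).fv := by simp [Form.fv]
  have hHbv : ∀ u, u ≠ x → u ≠ y → u ∉ φ.bv → u ∉ (all x B).bv := by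
    intro u h₁ h₂ h₃
    simp [hB, Form.bv, h₁, h₂, h₃]
  obtain ⟨z, hz⟩ := exists_fresh ({x, y} ∪ φ.fv ∪ φ.bv)
  obtain ⟨w, hw⟩ := exists_fresh ({x, y, z} ∪ φ.fv ∪ φ.bv)
  obtain ⟨v, hv⟩ := exists_fresh ({x, y, z, w} ∪ φ.fv ∪ φ.bv)
  simp only [Finset.mem_union, Finset.mem_insert, Finset.mem_singleton, not_or] at hz hw hv
  obtain ⟨⟨⟨hzx, hzy⟩, hzf⟩, hzb⟩ := hz
  obtain ⟨⟨⟨hwx, hwy, hwz⟩, hwf⟩, hwb⟩ := hw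
  obtain ⟨⟨⟨hvx, hvy, hvz, hvw⟩, hvf⟩, hvb⟩ := hv
  set A := φ.subst (sub₁ (var z) x) with hA
  have hAbv : A.bv = φ.bv := Form.bv_subst _ _
  have hAfv : ∀ u, u ≠ z → u ∉ φ.fv → u ∉ A.fv := by
    intro u huz hu h
    obtain ⟨rfl, -⟩ | ⟨-, h⟩ := Form.mem_fv_subst_sub₁_var h
    exacts [huz rfl, hu h]
  have hAy : ∀ t, A.subst (sub₁ t z) = φ.subst (sub₁ t x) := fun t =>
    Form.subst_sub₁_sub₁ t hzb hzf
  have main : RAProves ({all x B} ⟹ {A}) := by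
    refine RAProves.induction (z := z) (w := w) (v := v) hwz hvz hvw ?_ ?_ ?_ (hAbv ▸ hzb)
      ⟨hAfv w hwz hwf, hAbv ▸ hwb⟩ (hAfv v hvz hvf) ?_
    · simpa using ⟨hHfv z hzf, hHbv z hzx hzy hzb⟩
    · simpa using ⟨hHfv w hwf, hHbv w hwx hwy hwb⟩
    · simpa using hHfv v hvf
    rw [hAy]
    refine RAProves.allL (x := x) (φ := B) (var z) (by simp)
      (by simp [Form.Subst1Ok, Term.fv, hB, Form.bv, hzy, hzb]) ?_
    -- The inner `φ[y/x]` is unaffected because `x` is no longer free in it.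
    have hBz : B.subst (sub₁ (var z) x) =
        imp (all y (imp (lt (var y) (var z)) (φ.subst (sub₁ (var y) x)))) A := by
      have : (φ.subst (sub₁ (var y) x)).subst (update (sub₁ (var z) x) y (var y)) =
          φ.subst (sub₁ (var y) x) := by
        refine Form.subst_eq_self fun u hu => ?_
        have hux : u ≠ x := by
          rintro rfl
          obtain ⟨h, -⟩ | ⟨h, -⟩ := Form.mem_fv_subst_sub₁_var hu
          exacts [hyx h.symm, h rfl]
        by_cases huy : u = y <;> simp [huy, sub₁, hux]
      simp [hB, Form.subst, this, Term.subst, sub₁, hyx.symm, hA]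
    rw [hBz]
    refine RAProves.impL (Finset.mem_insert_self _ _) (RAProves.allR ?_ ?_)
      (RAProves.ax A (by simp) (by simp))
    · simp only [mem_fvs, Finset.mem_insert, Finset.mem_singleton]
      rintro (⟨ψ, rfl | rfl | rfl, h⟩ | ⟨ψ, rfl, h⟩)
      · simp [Form.fv, hAfv y (Ne.symm hzy) hyf] at h
      · simp only [Form.fv, Term.fv, Finset.mem_erase, Finset.mem_union, Finset.mem_singleton] at h
        obtain ⟨h₁, (h | h) | h⟩ := h
        · exact h₁ h
        · exact hzy h.symm
        · obtain ⟨h, -⟩ | ⟨-, h⟩ := Form.mem_fv_subst_sub₁_var h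
          exacts [h₁ h, hyf h]
      · exact hHfv y hyf h
      · exact hAfv y (Ne.symm hzy) hyf h
    -- The cycle quantifies over `w`, the axiom over `y`; instantiating `w` with `y` bridges the
    -- two.
    · refine RAProves.allL (x := w)
        (φ := imp (lt (var w) (var z)) (φ.subst (sub₁ (var w) x))) (var y) (by simp)
        (by simp [Form.Subst1Ok, Term.fv, Form.bv, hyb]) ?_
      have : (imp (lt (var w) (var z)) (φ.subst (sub₁ (var w) x))).subst (sub₁ (var y) w) =
          imp (lt (var y) (var z)) (φ.subst (sub₁ (var y) x)) := by
        rw [Form.subst, Form.subst_sub₁_sub₁ _ hwb hwf]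
        simp [Form.subst, Term.subst, sub₁, Ne.symm hwz]
      rw [this]
      exact RAProves.ax _ (Finset.mem_insert_self _ _) (Finset.mem_insert_self _ _)
  -- `Sub` cannot put `x` for `z` in `main`, since `x` is bound in the antecedent. Replacement only
  -- asks that the identity substitution capture nothing, so `x` may be bound in `φ`.
  have alpha : RAProves ({eq (var z) (var x), A} ⟹ {φ}) := by
    have hA' : A = φ.subst (update var x (var z)) := by rw [hA, sub₁_eq_update]
    have := RAProves.congr φ var x z x (φ.captureFree_var.update_var x hzb)
      (by rw [update_eq_self]; exact φ.captureFree_var)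
    rwa [← hA', update_eq_self, Form.subst_var] at this
  rw [ResetArithmetic.inductionFormula, ← hB]
  refine RAProves.impR (Δ := ∅) (RAProves.allR (Δ := ∅) ?_
    (RAProves.of_fresh_eq (v := x) (w := z) ?_ (RAProves.cut A ?_ ?_)))
  · simpa [fvs] using hHx
  · simpa [fvs] using ⟨hHfv z hzf, hzf⟩
  · exact main.mono (by simp) (by simp)
  · exact alpha.mono (by grind) (by simp)

/-! ### Translation of Peano proofs -/

theorem RAProves.of_paStep {S : CASeq} {L : List CASeq} (h : PAStep S L)
    (hL : ∀ S' ∈ L, RAProves S') : RAProves S := by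
  cases h with
  | ca _ _ h => exact step h hL
  | ind x y φ hxy hf hd =>
    exact inductionFormula hxy hf (by simpa [Form.Subst1Ok, Term.fv] using hd)

theorem RAProves.of_paProves {S : CASeq} (h : PAProves S) : RAProves S := by
  obtain ⟨P, hc, ha, rfl⟩ := h
  obtain ⟨N, hN⟩ : ∃ N, ∀ t ∈ P.nodes, t.length ≤ N :=
    ⟨P.nodes.sup List.length, fun t ht => Finset.le_sup (f := List.length) ht⟩
  -- Induction from the leaves to the root: `n` exceeds `N` minus the depth of the node, so `n = 0`
  -- is impossible.
  have key : ∀ n, ∀ t ∈ P.nodes, N < t.length + n → RAProves (P.lab t) := by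
    intro n
    induction n with
    | zero =>
      intro t ht hn
      exact absurd (hN t ht) (by omega)
    | succ n ih =>
      intro t ht hn
      cases hR : P.rule t with
      | none => exact absurd hR (hc t ⟨ht, P.rule_or_leaf t ht (ha t) hR⟩ (ha t))
      | some R =>
        rw [← P.rule_concl t R hR]
        refine of_paStep R.2 fun S' hS' => ?_
        obtain ⟨i, hi, rfl⟩ := List.getElem_of_mem hS'
        rw [← P.rule_prems t R hR i hi]
        refine ih _ ((P.rule_children t R hR _).2 ⟨by omega, hi⟩) ?_
        simp only [List.length_append, List.length_singleton]
        omega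
  exact key (N + 1) [] P.root_mem (by simp)

end ResetArithmetic

theorem mainTheorem6 (Γ Δ : Finset ResetArithmetic.Form)
    (h : ResetArithmetic.PAProves (ResetArithmetic.CASeq.mk Γ Δ)) :
    ResetArithmetic.RAProves (ResetArithmetic.CASeq.mk Γ Δ) :=
  ResetArithmetic.RAProves.of_paProves h
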